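/- **Graphs.** A path in a weighted directed graph is a finite walk of length at least one, and its weight is the sum of the (real) weights of its arcs. The graph *contains an $\infty$-weight path* if there are nodes $u,v$ and a sequence $\rho_1,\rho_2,\dots$ of paths from $u$ to $v$ whose weights tend to $+\infty$. Let $n\ge 1$ and let $L_{\mathsf n},C_{\mathsf n},R_{\mathsf n},C_{\mathsf t},L_{\mathsf p},C_{\mathsf p},R_{\mathsf p}$ be $n\times n$ matrices with entries in $\mathbb R\cup\{-\infty\}$. For $\mathsf x\in\{\mathsf n,\mathsf p\}$ put $X_{\mathsf x,-1}=L_{\mathsf x}$, $X_{\mathsf x,0}=C_{\mathsf x}$, $X_{\mathsf x,1}=R_{\mathsf x}$. The *ultimately periodic graph* $\mathcal G_{\mathrm U}$ given by these seven matrices has the nodes $(i,k)$, $i\in\{1,\dots,n\}$, $k\in\mathbb Z$. For $s\in\{-1,0,1\}$ it has an arc from $(i,k)$ to $(j,k+s)$ - if $k<0$ or $k+s<0$: exactly when $(X_{\mathsf n,s})_{ji}\ne-\infty$, with weight $(X_{\mathsf n,s})_{ji}$; - if $k>0$ or $k+s>0$: exactly when $(X_{\mathsf p,s})_{ji}\neq-\infty$,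 with weight $(X_{\mathsf p,s})_{ji}$; - if $k=s=0$: exactly when $(C_{\mathsf t})_{ji}\ne-\infty$, with weight $(C_{\mathsf t})_{ji}$; and it has no other arcs. The decision problem $\infty$-WEIGHT ULTIMATE-PATH asks, given the seven matrices, whether $\mathcal G_{\mathrm U}$ contains an $\infty$-weight path. **Theorem.** The problem $\infty$-WEIGHT ULTIMATE-PATH is solvable in strongly polynomial time $O(n^5)$. That is, there are a single program (not depending on $n$) for a random access machine over $\mathbb R\cup\{-\infty\}$ and a constant $K$ such that, for every $n\ge1$ and every instance of seven $n\times n$ matrices with entries in $\mathbb R\cup\{-\infty\}$, the program halts with the correct answer after at most $K n^5$ steps. Here one step is one elementary operation: an arithmetic operation, comparison or copy of elements of $\mathbb R\cup\{-\infty\}$, loading a rational constant or $-\infty$, an elementary operation ($+$, truncated $-$, $\times$, comparison, copy, loading a constant) on natural numbers used as counters and addresses, or a control step. Moreover, the counters and addresses are at all times bounded by a polynomial in $n$, and on instances with entries in $\mathbb Q\cup\{-\infty\}$ all the numbers in the data memory are at all times rational or $-\infty$, of binary encoding length bounded by a polynomial in the binary encoding length of the instance. -/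

import Mathlib

namespace UltimatePath

/-! ## Weighted digraphs, paths, and ∞-weight paths -/

/-- A weighted directed graph: a digraph with a real weight for each arc.
Only the values `w u v` with `Adj u v` are ever used. -/
structure WDigraph (V : Type) extends Digraph V where
  w : V → V → ℝ

namespace WDigraph

variable {V : Type} (G : WDigraph V)

/-- Paths of length at least one from a node to a node (a digraph has at most one arc from `u` to
`v`, so that a path is determined by its sequence of nodes). -/
inductive Path : V → V → Type
  | single {u v : V} (h : G.Adj u v) : Path u v
  | cons {u v x : V} (h : G.Adj u v) (p : Path v x) : Path u x

/-- The weight of a path is the sum of the weights of its arcs. -/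
def Path.weight {G : WDigraph V} : {u v : V} → G.Path u v → ℝ
  | u, v, .single _ => G.w u v
  | u, _, .cons (v := v) _ p => G.w u v + p.weight

/-- The graph contains an ∞-weight path: for some pair of nodes `(u, v)` there is a sequence of
paths from `u` to `v` whose weights tend to `+∞`. -/
def HasInfWeightPath : Prop :=
  ∃ (u v : V) (ρ : ℕ → G.Path u v),
    Filter.Tendsto (fun h => (ρ h).weight) Filter.atTop Filter.atTop

end WDigraph

/-! ## Static graphs and ultimately periodic graphs -/

/-- The matrix `X_s` of a static graph: `L`, `C`, `R` for `s = -1, 0, 1`; for all other `s` there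
are no arcs of shift `s`, and all entries are `-∞`. -/
def shiftMatrix {n : ℕ} (L C R : Matrix (Fin n) (Fin n) (WithBot ℝ)) (s : ℤ) :
    Matrix (Fin n) (Fin n) (WithBot ℝ) :=
  if s = -1 then L else if s = 0 then C else if s = 1 then R else fun _ _ => ⊥

/-- A static graph on the nodes `Fin n`, a weighted multi-directed graph whose arcs `(i, s, j)` go
from `i` to `j` with a shift `s`. Only the values `w i s j` with `Arc i s j` are ever used. -/
structure StaticGraph (n : ℕ) where
  Arc : Fin n → ℤ → Fin n → Prop
  w : Fin n → ℤ → Fin n → ℝ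

/-- The static graph `𝒢(L, C, R)`. -/
def staticGraph {n : ℕ} (L C R : Matrix (Fin n) (Fin n) (WithBot ℝ)) : StaticGraph n where
  Arc i s j := shiftMatrix L C R s j i ≠ ⊥
  w i s j := (shiftMatrix L C R s j i).unbotD 0

open Classical in
/-- The ultimately periodic graph `𝒢_U(𝒢_n, C_t, 𝒢_p)`, with nodes `(i, k)`, `k ∈ ℤ`. -/
noncomputable def ultimatelyPeriodicGraph {n : ℕ} (Gn : StaticGraph n)
    (Ct : Matrix (Fin n) (Fin n) (WithBot ℝ)) (Gp : StaticGraph n) : WDigraph (Fin n × ℤ) where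
  Adj u v :=
    ((u.2 < 0 ∨ v.2 < 0) ∧ Gn.Arc u.1 (v.2 - u.2) v.1) ∨
    ((0 < u.2 ∨ 0 < v.2) ∧ Gp.Arc u.1 (v.2 - u.2) v.1) ∨
    ((u.2 = 0 ∧ v.2 = 0) ∧ Ct v.1 u.1 ≠ ⊥)
  w u v :=
    if u.2 < 0 ∨ v.2 < 0 then Gn.w u.1 (v.2 - u.2) v.1
    else if 0 < u.2 ∨ 0 < v.2 then Gp.w u.1 (v.2 - u.2) v.1
    else (Ct v.1 u.1).unbotD 0

/-! ## The decision problem -/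

/-- Seven `n × n` matrices over `α ∪ {-∞}`. -/
structure Instance (α : Type) (n : ℕ) where
  Ln : Matrix (Fin n) (Fin n) (WithBot α)
  Cn : Matrix (Fin n) (Fin n) (WithBot α)
  Rn : Matrix (Fin n) (Fin n) (WithBot α)
  Ct : Matrix (Fin n) (Fin n) (WithBot α)
  Lp : Matrix (Fin n) (Fin n) (WithBot α)
  Cp : Matrix (Fin n) (Fin n) (WithBot α)
  Rp : Matrix (Fin n) (Fin n) (WithBot α)

namespace Instance

variable {α β : Type} {n : ℕ}

/-- The seven matrices in the order in which they are given. -/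
def mats (I : Instance α n) : Fin 7 → Matrix (Fin n) (Fin n) (WithBot α) :=
  ![I.Ln, I.Cn, I.Rn, I.Ct, I.Lp, I.Cp, I.Rp]

/-- Apply a map to all entries different from `-∞`. -/
def map (f : α → β) (I : Instance α n) : Instance β n where
  Ln i j := (I.Ln i j).map f
  Cn i j := (I.Cn i j).map f
  Rn i j := (I.Rn i j).map f
  Ct i j := (I.Ct i j).map f
  Lp i j := (I.Lp i j).map f
  Cp i j := (I.Cp i j).map f
  Rp i j := (I.Rp i j).map f

end Instance

/-- The problem `∞-WEIGHT ULTIMATE-PATH`: the answer to the instance is yes. -/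
def InfWeightUltimatePath (n : ℕ) (I : Instance ℝ n) : Prop :=
  (ultimatelyPeriodicGraph (staticGraph I.Ln I.Cn I.Rn) I.Ct
    (staticGraph I.Lp I.Cp I.Rp)).HasInfWeightPath

/-! ## The arithmetic model of computation: a real random access machine

The machine has two memories, indexed by the natural numbers: one of natural numbers (used for
counters and addresses) and one of elements of `ℝ ∪ {-∞}`, with direct and indirect addressing.
Programs are finite and structured. Each step does a bounded amount of work on a bounded number of
cells. Real numbers can only be added, subtracted, multiplied, divided, copied and compared, and
`-∞` is a symbol that a data cell can hold instead of a number. -/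

/-- An operand: the cell with a given address (`dir a`), or the cell whose address is stored in the
integer cell `a` (`ind a`). -/
inductive Operand
  | dir (a : ℕ)
  | ind (a : ℕ)

/-- Operations on natural numbers; `sub` is truncated at zero. -/
inductive NatOp
  | add | sub | mul

/-- The arithmetic operations on real numbers. -/
inductive RealOp
  | add | sub | mul | div

/-- Elementary instructions; in each, `x` is the cell that is written. -/
inductive Instr
  /-- write the constant `c` to the integer cell `x` -/
  | natConst (x : Operand) (c : ℕ)
  /-- copy the integer cell `y` to `x` -/
  | natCopy (x y : Operand)
  /-- write the result of an operation on the integer cells `y` and `z` to `x` -/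
  | natOp (o : NatOp) (x y z : Operand)
  /-- write the constant `c` (a rational number or `-∞`) to the data cell `x` -/
  | realConst (x : Operand) (c : WithBot ℚ)
  /-- copy the data cell `y` to `x` -/
  | realCopy (x y : Operand)
  /-- write the result of an operation on the data cells `y` and `z` to `x` -/
  | realOp (o : RealOp) (x y z : Operand)

/-- Tests: a strict comparison of two integer cells or of two data cells. -/
inductive Test
  | natLt (y z : Operand)
  | realLt (y z : Operand)

/-- Programs. -/
inductive Prog
  | skip
  | instr (i : Instr)
  | seq (c d : Prog)
  | ite (b : Test) (c d : Prog)
  | while (b : Test) (c : Prog)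

/-- The contents of the two memories. -/
structure Store where
  int : ℕ → ℕ
  num : ℕ → WithBot ℝ

/-- The address that an operand refers to. -/
def Operand.addr (s : Store) : Operand → ℕ
  | .dir a => a
  | .ind a => s.int a

def NatOp.eval : NatOp → ℕ → ℕ → ℕ
  | .add, a, b => a + b
  | .sub, a, b => a - b
  | .mul, a, b => a * b

/-- The result of an arithmetic operation, which is `-∞` as soon as one argument is `-∞`; division
by zero returns zero. On `ℝ ∪ {-∞}`, `add` is the multiplication of the max-plus algebra. -/
noncomputable def RealOp.eval : RealOp → WithBot ℝ → WithBot ℝ → WithBot ℝ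
  | .add => WithBot.map₂ (fun a b => a + b)
  | .sub => WithBot.map₂ (fun a b => a - b)
  | .mul => WithBot.map₂ (fun a b => a * b)
  | .div => WithBot.map₂ (fun a b => a / b)

def Store.setInt (s : Store) (x : Operand) (v : ℕ) : Store :=
  { s with int := Function.update s.int (x.addr s) v }

def Store.setNum (s : Store) (x : Operand) (v : WithBot ℝ) : Store :=
  { s with num := Function.update s.num (x.addr s) v }

/-- The effect of an instruction. -/
noncomputable def Instr.exec (s : Store) : Instr → Store
  | .natConst x c => s.setInt x c
  | .natCopy x y => s.setInt x (s.int (y.addr s))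
  | .natOp o x y z => s.setInt x (o.eval (s.int (y.addr s)) (s.int (z.addr s)))
  | .realConst x c => s.setNum x (c.map (fun q : ℚ => (q : ℝ)))
  | .realCopy x y => s.setNum x (s.num (y.addr s))
  | .realOp o x y z => s.setNum x (o.eval (s.num (y.addr s)) (s.num (z.addr s)))

/-- The outcome of a test; for data cells `-∞` is less than every real number. -/
def Test.Holds (s : Store) : Test → Prop
  | .natLt y z => s.int (y.addr s) < s.int (z.addr s)
  | .realLt y z => s.num (y.addr s) < s.num (z.addr s)

/-- A configuration: the stack of programs that remain to be executed, and the store. -/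
abbrev Config := List Prog × Store

open Classical in
/-- One step of the machine. A configuration with empty stack is halted. -/
noncomputable def step : Config → Config
  | ([], s) => ([], s)
  | (.skip :: K, s) => (K, s)
  | (.instr i :: K, s) => (K, i.exec s)
  | (.seq c d :: K, s) => (c :: d :: K, s)
  | (.ite b c d :: K, s) => if b.Holds s then (c :: K, s) else (d :: K, s)
  | (.while b c :: K, s) => if b.Holds s then (c :: .while b c :: K, s) else (K, s)

/-- The store at the start: the integer cell `0` holds `n`, and the data cells with addresses
`0, …, 7n² - 1` hold the entries of the seven matrices (entry `(i, j)` of the `k`-th matrix, all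
counted from zero, at the address `k n² + i n + j`). All other cells hold zero. -/
noncomputable def inputStore {n : ℕ} (I : Instance ℝ n) : Store where
  int a := if a = 0 then n else 0
  num a :=
    if h : a < 7 * (n * n) then
      let p := (finProdFinEquiv (m := 7) (n := n * n)).symm ⟨a, h⟩
      let q := (finProdFinEquiv (m := n) (n := n)).symm p.2
      I.mats p.1 q.1 q.2
    else 0

/-- The configuration of the program `c` after `t` steps on the given instance. -/
noncomputable def run (c : Prog) {n : ℕ} (I : Instance ℝ n) (t : ℕ) : Config :=
  step^[t] ([c], inputStore I)

/-- The program `c` decides the problem `Q` in time `T`: on each instance of size `n ≥ 1` it halts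
after at most `T n` steps, with `1` in the integer cell `0` if the answer is yes, and with `0` there
if the answer is no. -/
def DecidesInTime (c : Prog) (Q : (n : ℕ) → Instance ℝ n → Prop) (T : ℕ → ℕ) : Prop :=
  ∀ n : ℕ, 1 ≤ n → ∀ I : Instance ℝ n, ∃ t ≤ T n,
    (run c I t).1 = [] ∧
    (Q n I → (run c I t).2.int 0 = 1) ∧ (¬ Q n I → (run c I t).2.int 0 = 0)

/-- The binary encoding length of an element of `ℚ ∪ {-∞}`: one (for the sign or the symbol `-∞`)
plus the numbers of binary digits of the numerator and of the denominator. -/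
def encLen : WithBot ℚ → ℕ
  | ⊥ => 1
  | (q : ℚ) => 1 + Nat.size q.num.natAbs + Nat.size q.den

/-- The binary encoding length of a rational instance. -/
def Instance.encLen {n : ℕ} (I : Instance ℚ n) : ℕ :=
  ∑ k, ∑ i, ∑ j, UltimatePath.encLen (I.mats k i j)

/-- The numbers that the program handles stay of polynomial size, as required of a strongly
polynomial algorithm besides a polynomial bound on the number of steps:
the counters and addresses are at most polynomial in `n`, and on rational instances all data cells
hold, at all times, rational numbers (or `-∞`) of encoding length polynomial in that of the
instance. -/
def PolynomiallyBoundedNumbers (c : Prog) : Prop :=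
  (∃ p : Polynomial ℕ, ∀ n : ℕ, 1 ≤ n → ∀ (I : Instance ℝ n) (t a : ℕ),
    (run c I t).2.int a ≤ p.eval n) ∧
  (∃ p : Polynomial ℕ, ∀ n : ℕ, 1 ≤ n → ∀ (I : Instance ℚ n) (t a : ℕ),
    ∃ q : WithBot ℚ,
      (run c (I.map (fun x : ℚ => (x : ℝ))) t).2.num a = q.map (fun x : ℚ => (x : ℝ)) ∧
      encLen q ≤ p.eval I.encLen)

end UltimatePath

namespace UltimatePath

/-! ## Weighted derivation trees -/

/-! An arc leads away from level zero, stays in its level, or leads towards level zero. The graph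
looks the same at all levels on one side of zero, so an excursion that leaves a level away from zero
and later returns may be treated as a new level arc. This gives a context-free grammar with one
nonterminal per matrix entry, whose productions `composeRules` merge level with level, away with
level, and away with towards. Once a start level is fixed, all derivation trees with a given root
label are paths between the same two nodes (`DTree.IsDer.exists_path`). Unbounded tree weights
therefore give an ∞-weight path.

Conversely, suppose that some matrices dominate the input and are closed under the productions
(`ClosedAbove`). Then every path can be rewritten, without loss of weight, as one that first moves
towards zero with at most one level arc in each level and then only away (`NormalPath.exists_cons`).
The number of arcs of such a path is bounded in terms of its endpoints, hence so is its weight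
(`ClosedAbove.not_hasInfWeightPath`).

Relaxation in the manner of Bellman and Ford separates the two cases. After `r` rounds the entries
dominate all trees of depth at most `r + 1`. If tree weights are bounded, pumping shows that depth
`7n²`, the number of labels, suffices for optimality (`DTree.Bounded.exists_depth_le`), so round
`7n²` changes nothing. If that round changes nothing, the entries are closed. A round costs `O(n³)`,
in total `O(n⁵)`. The data undergo only additions, so encoding lengths grow at most linearly with
time. -/

/-- Binary trees with labelled nodes. -/
inductive DTree (α : Type)
  | leaf (a : α)
  | node (a : α) (l r : DTree α)

namespace DTree

variable {α : Type}

def root : DTree α → α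
  | leaf a => a
  | node a _ _ => a

def depth : DTree α → ℕ
  | leaf _ => 1
  | node _ l r => max l.depth r.depth + 1

def size : DTree α → ℕ
  | leaf _ => 1
  | node _ l r => l.size + r.size + 1

/-- The tree `s` is a subtree of the given tree. -/
def Sub (s : DTree α) : DTree α → Prop
  | leaf a => s = leaf a
  | node a l r => s = node a l r ∨ Sub s l ∨ Sub s r

/-- Derivation trees of the grammar with the binary productions `rule`, in which `a` produces a
terminal symbol of weight `M a` when `M a ≠ -∞`. -/
def IsDer (rule : α → α → α → Prop) (M : α → WithBot ℝ) : DTree α → Prop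
  | leaf a => M a ≠ ⊥
  | node a l r => rule a l.root r.root ∧ IsDer rule M l ∧ IsDer rule M r

def weight (M : α → WithBot ℝ) : DTree α → ℝ
  | leaf a => (M a).unbotD 0
  | node _ l r => l.weight M + r.weight M

theorem Sub.refl (t : DTree α) : Sub t t := by
  cases t <;> simp [Sub]

theorem Sub.trans {s t u : DTree α} (h : Sub s t) (h' : Sub t u) : Sub s u := by
  induction u with
  | leaf a => simp only [Sub] at h'; subst h'; exact h
  | node a l r ihl ihr =>
    rcases h' with h' | h' | h'
    · subst h'; exact h
    · exact Or.inr (Or.inl (ihl h'))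
    · exact Or.inr (Or.inr (ihr h'))

variable {rule : α → α → α → Prop} {M : α → WithBot ℝ}

theorem IsDer.sub {s t : DTree α} (ht : t.IsDer rule M) (h : Sub s t) : s.IsDer rule M := by
  induction t with
  | leaf a => simp only [Sub] at h; subst h; exact ht
  | node a l r ihl ihr =>
    rcases h with h | h | h
    · subst h; exact ht
    · exact ihl ht.2.1 h
    · exact ihr ht.2.2 h

/-- A subtree can be replaced by another tree with the same root label. -/
theorem IsDer.replace {s t : DTree α} (ht : t.IsDer rule M) (h : Sub s t) {s' : DTree α}
    (hs' : s'.IsDer rule M) (hr : s'.root = s.root) :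
    ∃ t' : DTree α, t'.IsDer rule M ∧ t'.root = t.root ∧
      t'.weight M = t.weight M - s.weight M + s'.weight M := by
  induction t with
  | leaf a => simp only [Sub] at h; subst h; exact ⟨s', hs', hr, by ring⟩
  | node a l r ihl ihr =>
    rcases h with h | h | h
    · subst h; exact ⟨s', hs', hr, by ring⟩
    · obtain ⟨l', h1, h2, h3⟩ := ihl ht.2.1 h
      refine ⟨node a l' r, ⟨h2 ▸ ht.1, h1, ht.2.2⟩, rfl, ?_⟩
      simp only [weight, h3]; ring
    · obtain ⟨r', h1, h2, h3⟩ := ihr ht.2.2 h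
      refine ⟨node a l r', ⟨h2 ▸ ht.1, ht.2.1, h1⟩, rfl, ?_⟩
      simp only [weight, h3]; ring

/-- For every label, the weights of the derivation trees with this label are bounded above. -/
def Bounded (rule : α → α → α → Prop) (M : α → WithBot ℝ) : Prop :=
  ∀ a, ∃ b : ℝ, ∀ t : DTree α, t.IsDer rule M → t.root = a → t.weight M ≤ b

/-- Pumping: a repeated label does not increase the weight. -/
theorem Bounded.weight_le_of_sub (hb : Bounded rule M) {s t : DTree α} (ht : t.IsDer rule M)
    (h : Sub s t) (hr : s.root = t.root) : t.weight M ≤ s.weight M := by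
  by_contra! hlt
  obtain ⟨b, hb⟩ := hb t.root
  have pump : ∀ k : ℕ, ∃ t' : DTree α, t'.IsDer rule M ∧ t'.root = t.root ∧
      t'.weight M = t.weight M + k * (t.weight M - s.weight M) := by
    intro k
    induction k with
    | zero => exact ⟨t, ht, rfl, by simp⟩
    | succ k ih =>
      obtain ⟨t', h1, h2, h3⟩ := ih
      obtain ⟨t'', h4, h5, h6⟩ := ht.replace h h1 (h2.trans hr.symm)
      exact ⟨t'', h4, h5, by rw [h6, h3]; push_cast; ring⟩
  obtain ⟨k, hk⟩ := exists_lt_nsmul (sub_pos.2 hlt) (b - t.weight M)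
  obtain ⟨t', h1, h2, h3⟩ := pump k
  have := hb t' h1 h2
  rw [nsmul_eq_mul] at hk
  linarith

/-- A derivation tree has a subtree with the same root label in which this label is not repeated. -/
theorem exists_sub_root_eq (t : DTree α) : ∃ s : DTree α, Sub s t ∧ s.root = t.root ∧
    ∀ u : DTree α, Sub u s → u.root = t.root → s.size ≤ u.size := by
  classical
  have hex : ∃ m, ∃ s : DTree α, Sub s t ∧ s.root = t.root ∧ s.size = m :=
    ⟨_, t, Sub.refl t, rfl, rfl⟩
  obtain ⟨s, h1, h2, h3⟩ := Nat.find_spec hex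
  exact ⟨s, h1, h2, fun u hu hur => h3 ▸ Nat.find_min' hex ⟨u, hu.trans h1, hur, rfl⟩⟩

theorem Sub.size_le {s t : DTree α} (h : Sub s t) : s.size ≤ t.size := by
  induction t with
  | leaf a => simp only [Sub] at h; subst h; exact le_rfl
  | node a l r ihl ihr =>
    rcases h with h | h | h
    · subst h; exact le_rfl
    · have := ihl h; simp only [size]; omega
    · have := ihr h; simp only [size]; omega

/-- If the weights are bounded, then each derivation tree is dominated by one whose depth is at most
the number of labels. -/
theorem Bounded.exists_depth_le [Fintype α] (hb : Bounded rule M) {t : DTree α}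
    (ht : t.IsDer rule M) : ∃ t' : DTree α, t'.IsDer rule M ∧ t'.root = t.root ∧
      t.weight M ≤ t'.weight M ∧ t'.depth ≤ Fintype.card α := by
  classical
  -- `S` collects the labels met on the way down from the root; `d` bounds the number of labels
  -- still available.
  suffices H : ∀ (d : ℕ) (S : Finset α) (t : DTree α), (Sᶜ).card ≤ d → t.IsDer rule M →
      (∀ s, Sub s t → s.root ∉ S) → ∃ t' : DTree α, t'.IsDer rule M ∧ t'.root = t.root ∧
      t.weight M ≤ t'.weight M ∧ t'.depth ≤ d by
    exact H _ ∅ t (by simp) ht (by simp)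
  intro d
  induction d with
  | zero =>
    intro S t hd _ hS
    have : Sᶜ = ∅ := Finset.card_eq_zero.1 (Nat.le_zero.1 hd)
    have h2 : t.root ∈ Sᶜ := Finset.mem_compl.2 (hS t (Sub.refl t))
    simp [this] at h2
  | succ d ih =>
    intro S t hd ht hS
    -- Passing to the smallest subtree with the root label loses no weight by pumping, and below its
    -- root this label never recurs, so it can join `S`.
    obtain ⟨s, hst, hsr, hmin⟩ := exists_sub_root_eq t
    have hw := hb.weight_le_of_sub ht hst hsr
    have hs := ht.sub hst
    cases s with
    | leaf a => exact ⟨leaf a, hs, hsr, hw, by simp [depth]⟩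
    | node a l r =>
      simp only [root] at hsr
      have haS : a ∉ S := hS _ hst
      have hcard : ((insert a S)ᶜ).card ≤ d := by
        rw [Finset.compl_insert, Finset.card_erase_of_mem (Finset.mem_compl.2 haS)]
        omega
      have key : ∀ c : DTree α, Sub c (node a l r) → c.size < (node a l r).size →
          ∀ u, Sub u c → u.root ∉ insert a S := by
        intro c hc hlt u hu hmem
        rcases Finset.mem_insert.1 hmem with h | h
        · have := hmin u (hu.trans hc) (h.trans hsr)
          have := hu.size_le
          omega
        · exact hS u ((hu.trans hc).trans hst) h
      obtain ⟨l', hl1, hl2, hl3, hl4⟩ := ih _ l hcard hs.2.1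
        (key l (Or.inr (Or.inl (Sub.refl l))) (by simp only [size]; omega))
      obtain ⟨r', hr1, hr2, hr3, hr4⟩ := ih _ r hcard hs.2.2
        (key r (Or.inr (Or.inr (Sub.refl r))) (by simp only [size]; omega))
      refine ⟨node a l' r', ⟨hl2 ▸ hr2 ▸ hs.1, hl1, hr1⟩, hsr, ?_, ?_⟩
      · simp only [weight] at hw ⊢; linarith
      · simp only [depth]; omega

end DTree

/-! ## The grammar of an ultimately periodic graph -/

/-- Positions in the seven matrices. -/
abbrev Entry (n : ℕ) : Type := Fin 7 × Fin n × Fin n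

/-- The triples `(z, u, v)` for which a path of type `v` followed by one of type `u` is a path of
type `z`. -/
def composeRules : List (Fin 7 × Fin 7 × Fin 7) :=
  [(1, 1, 1), (3, 3, 3), (5, 5, 5), (0, 1, 0), (1, 2, 0), (3, 2, 0), (6, 5, 6), (5, 4, 6),
    (3, 4, 6)]

def Compose {n : ℕ} (a b c : Entry n) : Prop :=
  (a.1, b.1, c.1) ∈ composeRules ∧ b.2.1 = a.2.1 ∧ c.2.1 = b.2.2 ∧ c.2.2 = a.2.2

def Instance.entry {α : Type} {n : ℕ} (I : Instance α n) (a : Entry n) : WithBot α :=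
  I.mats a.1 a.2.1 a.2.2

/-- The shift of the arcs given by each of the seven matrices. -/
def shift : Fin 7 → ℤ := ![-1, 0, 1, 0, -1, 0, 1]

/-- The levels at which the arcs given by a matrix start. -/
def StartsAt (k : ℤ) : Fin 7 → Prop :=
  ![k ≤ 0, k ≤ -1, k ≤ -1, k = 0, 1 ≤ k, 1 ≤ k, 0 ≤ k]

/-- Arcs that lead away from level zero (`0`), stay in their level (`1`), or lead towards level zero
(`2`). -/
def direction : Fin 7 → Fin 3 := ![0, 1, 2, 1, 2, 1, 0]

noncomputable def Instance.graph {n : ℕ} (I : Instance ℝ n) : WDigraph (Fin n × ℤ) :=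
  ultimatelyPeriodicGraph (staticGraph I.Ln I.Cn I.Rn) I.Ct (staticGraph I.Lp I.Cp I.Rp)

section Graph

variable {n : ℕ} (I : Instance ℝ n)

theorem shiftMatrix_eq_bot {L C R : Matrix (Fin n) (Fin n) (WithBot ℝ)} {s : ℤ} (h1 : s ≠ -1)
    (h2 : s ≠ 0) (h3 : s ≠ 1) (i j : Fin n) : shiftMatrix L C R s i j = ⊥ := by
  have : shiftMatrix L C R s = fun _ _ => ⊥ :=
    (if_neg h1).trans ((if_neg h2).trans (if_neg h3))
  rw [this]

/-- For each level and each shift in `{-1, 0, 1}` exactly one of the seven matrices is responsible,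
and `StartsAt` records which; the case distinction in the weight of the graph then disappears. -/
theorem Instance.graph_arc {m : Fin 7} {k : ℤ} {i j : Fin n} (hk : StartsAt k m)
    (h : I.entry (m, i, j) ≠ ⊥) :
    I.graph.Adj (j, k) (i, k + shift m) ∧
      I.graph.w (j, k) (i, k + shift m) = (I.entry (m, i, j)).unbotD 0 := by
  have hneg : ∀ s : ℤ, (k < 0 ∨ k + s < 0) → shiftMatrix I.Ln I.Cn I.Rn s i j ≠ ⊥ →
      I.graph.Adj (j, k) (i, k + s) ∧ I.graph.w (j, k) (i, k + s) =
        (shiftMatrix I.Ln I.Cn I.Rn s i j).unbotD 0 := by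
    intro s h1 h2
    rw [← add_sub_cancel_left k s] at h2
    exact ⟨Or.inl ⟨h1, h2⟩, (if_pos h1).trans (by simp only [staticGraph, add_sub_cancel_left])⟩
  have hpos : ∀ s : ℤ, ¬ (k < 0 ∨ k + s < 0) → (0 < k ∨ 0 < k + s) →
      shiftMatrix I.Lp I.Cp I.Rp s i j ≠ ⊥ →
      I.graph.Adj (j, k) (i, k + s) ∧ I.graph.w (j, k) (i, k + s) =
        (shiftMatrix I.Lp I.Cp I.Rp s i j).unbotD 0 := by
    intro s h0 h1 h2
    rw [← add_sub_cancel_left k s] at h2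
    exact ⟨Or.inr (Or.inl ⟨h1, h2⟩), (if_neg h0).trans
      ((if_pos h1).trans (by simp only [staticGraph, add_sub_cancel_left]))⟩
  have hzero : ∀ l : ℤ, ¬ (k < 0 ∨ l < 0) → ¬ (0 < k ∨ 0 < l) →
      I.graph.w (j, k) (i, l) = (I.Ct i j).unbotD 0 :=
    fun l h0 h1 => (if_neg h0).trans (if_neg h1)
  fin_cases m <;> simp [StartsAt] at hk
  · exact hneg (-1) (by omega) h
  · exact hneg 0 (by omega) h
  · exact hneg 1 (by omega) h
  · subst hk
    have h1 : ¬ ((0 : ℤ) < 0 ∨ (0 : ℤ) + 0 < 0) := by omega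
    exact ⟨Or.inr (Or.inr ⟨⟨rfl, rfl⟩, h⟩), hzero _ h1 h1⟩
  · exact hpos (-1) (by omega) (by omega) h
  · exact hpos 0 (by omega) (by omega) h
  · exact hpos 1 (by omega) (by omega) h

theorem Instance.exists_of_graph_adj {k l : ℤ} {i j : Fin n} (h : I.graph.Adj (j, k) (i, l)) :
    ∃ m, StartsAt k m ∧ l = k + shift m ∧
      I.entry (m, i, j) = (I.graph.w (j, k) (i, l) : WithBot ℝ) := by
  obtain ⟨s, rfl⟩ : ∃ s, l = k + s := ⟨l - k, by ring⟩
  suffices H : ∃ m, StartsAt k m ∧ s = shift m ∧ I.entry (m, i, j) ≠ ⊥ by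
    obtain ⟨m, h1, rfl, h3⟩ := H
    refine ⟨m, h1, rfl, ?_⟩
    rw [(I.graph_arc h1 h3).2]
    obtain ⟨c, hc⟩ := WithBot.ne_bot_iff_exists.1 h3
    simp [← hc]
  simp only [Instance.graph, ultimatelyPeriodicGraph, staticGraph, add_sub_cancel_left] at h
  rcases h with ⟨h, h'⟩ | ⟨h, h'⟩ | ⟨h, h'⟩
  · by_cases h1 : s = -1
    · subst h1; exact ⟨0, by simp [StartsAt]; omega, rfl, h'⟩
    by_cases h2 : s = 0
    · subst h2; exact ⟨1, by simp [StartsAt]; omega, rfl, h'⟩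
    by_cases h3 : s = 1
    · subst h3; exact ⟨2, by simp [StartsAt]; omega, rfl, h'⟩
    exact absurd (shiftMatrix_eq_bot h1 h2 h3 i j) h'
  · by_cases h1 : s = -1
    · subst h1; exact ⟨4, by simp [StartsAt]; omega, rfl, h'⟩
    by_cases h2 : s = 0
    · subst h2; exact ⟨5, by simp [StartsAt]; omega, rfl, h'⟩
    by_cases h3 : s = 1
    · subst h3; exact ⟨6, by simp [StartsAt]; omega, rfl, h'⟩
    exact absurd (shiftMatrix_eq_bot h1 h2 h3 i j) h'
  · exact ⟨3, by simp [StartsAt]; omega, by simp [shift]; omega, h'⟩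

/-! ### Derivation trees as paths. -/

/-- Concatenation of paths. -/
theorem WDigraph.Path.exists_append {V : Type} {G : WDigraph V} {u v x : V} (p : G.Path u v)
    (q : G.Path v x) : ∃ r : G.Path u x, r.weight = p.weight + q.weight := by
  induction p with
  | single h => exact ⟨.cons h q, rfl⟩
  | cons h p ih =>
    obtain ⟨r, hr⟩ := ih q
    exact ⟨.cons h r, by simp only [Path.weight, hr]; ring⟩

/-- Each production is valid at every level where its left-hand side may start. This includes
excursions from level zero, whose result is attributed to `C_t`. -/
theorem startsAt_of_mem_composeRules {z u v : Fin 7} (h : (z, u, v) ∈ composeRules) {k : ℤ}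
    (hk : StartsAt k z) :
    StartsAt k v ∧ StartsAt (k + shift v) u ∧ shift z = shift v + shift u := by
  simp only [composeRules, List.mem_cons, Prod.mk.injEq, List.not_mem_nil, or_false] at h
  rcases h with ⟨rfl, rfl, rfl⟩ | ⟨rfl, rfl, rfl⟩ | ⟨rfl, rfl, rfl⟩ | ⟨rfl, rfl, rfl⟩ |
    ⟨rfl, rfl, rfl⟩ | ⟨rfl, rfl, rfl⟩ | ⟨rfl, rfl, rfl⟩ | ⟨rfl, rfl, rfl⟩ | ⟨rfl, rfl, rfl⟩ <;>
  simp [StartsAt, shift] at hk ⊢ <;> omega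

/-- Each derivation tree yields a path of the same weight. -/
theorem DTree.IsDer.exists_path {t : DTree (Entry n)} (ht : t.IsDer Compose I.entry) {k : ℤ}
    (hk : StartsAt k t.root.1) :
    ∃ p : I.graph.Path (t.root.2.2, k) (t.root.2.1, k + shift t.root.1),
      p.weight = t.weight I.entry := by
  -- The endpoints become variables with equations, which avoids transporting paths along equalities
  -- of nodes.
  suffices H : ∀ u v : Fin n × ℤ, u = (t.root.2.2, k) → v = (t.root.2.1, k + shift t.root.1) →
      ∃ p : I.graph.Path u v, p.weight = t.weight I.entry from H _ _ rfl rfl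
  induction t generalizing k with
  | leaf a =>
    rintro u v rfl rfl
    obtain ⟨h1, h2⟩ := I.graph_arc hk ht
    exact ⟨.single h1, h2⟩
  | node a l r ihl ihr =>
    rintro u v hu hv
    obtain ⟨⟨h1, h2, h3, h4⟩, hl, hr⟩ := ht
    obtain ⟨hkr, hkl, hs⟩ := startsAt_of_mem_composeRules h1 hk
    -- As in a matrix product, columns are sources and rows are targets, so the right subtree is
    -- traversed first.
    obtain ⟨p, hp⟩ := ihr hr hkr u (l.root.2.2, k + shift r.root.1) (by rw [hu, h4]; rfl)
      (by rw [h3])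
    obtain ⟨q, hq⟩ := ihl hl hkl _ v rfl (by rw [hv, h2, add_assoc, ← hs]; rfl)
    obtain ⟨x, hx⟩ := p.exists_append q
    exact ⟨x, by rw [hx, hp, hq, weight, add_comm]⟩

theorem exists_startsAt (m : Fin 7) : ∃ k, StartsAt k m := by
  fin_cases m
  · exact ⟨0, by simp [StartsAt]⟩
  · exact ⟨-1, by simp [StartsAt]⟩
  · exact ⟨-1, by simp [StartsAt]⟩
  · exact ⟨0, by simp [StartsAt]⟩
  · exact ⟨1, by simp [StartsAt]⟩
  · exact ⟨1, by simp [StartsAt]⟩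
  · exact ⟨0, by simp [StartsAt]⟩

theorem hasInfWeightPath_of_not_bounded (h : ¬ DTree.Bounded Compose I.entry) :
    I.graph.HasInfWeightPath := by
  simp only [DTree.Bounded, not_forall, not_exists, not_le] at h
  obtain ⟨a, ha⟩ := h
  obtain ⟨k, hk⟩ := exists_startsAt a.1
  have : ∀ N : ℕ, ∃ p : I.graph.Path (a.2.2, k) (a.2.1, k + shift a.1), (N : ℝ) ≤ p.weight := by
    intro N
    obtain ⟨t, ht, rfl, hN⟩ := ha N
    obtain ⟨p, hp⟩ := ht.exists_path I hk
    exact ⟨p, hp ▸ hN.le⟩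
  choose ρ hρ using this
  exact ⟨_, _, ρ, Filter.tendsto_atTop_mono hρ tendsto_natCast_atTop_atTop⟩

/-! ## Closed matrices bound the weights of all paths -/

/-- The entries are at least those of the instance, and closed under composition. -/
structure ClosedAbove (X : Entry n → WithBot ℝ) : Prop where
  le : ∀ a, I.entry a ≤ X a
  add_le : ∀ a b c, Compose a b c → X b + X c ≤ X a

/-- Paths to `(i, l)` in normal form, with arcs weighted by `X`: first towards level zero, with at
most one arc in each level, and then away from level zero. The first index is the direction of the
first arc. -/
inductive NormalPath (X : Entry n → WithBot ℝ) (i : Fin n) (l : ℤ) :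
    Fin 3 → Fin n → ℤ → ℝ → Prop
  | nil : NormalPath X i l 0 i l 0
  | away {m j j' k a w} : StartsAt k m → direction m = 0 → X (m, j', j) = (a : ℝ) →
      NormalPath X i l 0 j' (k + shift m) w → NormalPath X i l 0 j k (a + w)
  | level {m j j' k a w d} : StartsAt k m → direction m = 1 → X (m, j', j) = (a : ℝ) → d ≠ 1 →
      NormalPath X i l d j' (k + shift m) w → NormalPath X i l 1 j k (a + w)
  | towards {m j j' k a w d} : StartsAt k m → direction m = 2 → X (m, j', j) = (a : ℝ) →
      NormalPath X i l d j' (k + shift m) w → NormalPath X i l 2 j k (a + w)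

/-- These are exactly the pairs of consecutive arcs that a normal form forbids. An away arc followed
by a towards arc closes an excursion and becomes a level arc, of type 3 if it starts at level zero
and of type 1 or 5 otherwise. -/
theorem exists_composeRules {m m' : Fin 7} {k : ℤ} (hm : StartsAt k m)
    (hm' : StartsAt (k + shift m) m')
    (h : direction m = 0 ∧ direction m' ≠ 0 ∨ direction m = 1 ∧ direction m' = 1) :
    ∃ z, (z, m', m) ∈ composeRules ∧ StartsAt k z ∧ shift z = shift m + shift m' ∧
      direction z = if direction m' = 2 then 1 else direction m := by
  fin_cases m <;> fin_cases m' <;> simp [direction] at h <;>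
    simp [StartsAt, shift] at hm hm' <;> try omega
  · exact ⟨0, by simp [composeRules, StartsAt, shift, direction]; omega⟩
  · rcases hm.lt_or_eq with h | h
    · exact ⟨1, by simp [composeRules, StartsAt, shift, direction]; omega⟩
    · exact ⟨3, by simp [composeRules, StartsAt, shift, direction]; omega⟩
  · exact ⟨1, by simp [composeRules, StartsAt, shift, direction]; omega⟩
  · exact ⟨3, by simp [composeRules, StartsAt, shift, direction]; omega⟩
  · exact ⟨5, by simp [composeRules, StartsAt, shift, direction]; omega⟩
  · rcases hm.lt_or_eq with h | h
    · exact ⟨5, by simp [composeRules, StartsAt, shift, direction]; omega⟩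
    · exact ⟨3, by simp [composeRules, StartsAt, shift, direction]; omega⟩
  · exact ⟨6, by simp [composeRules, StartsAt, shift, direction]; omega⟩

variable {I} {X : Entry n → WithBot ℝ}

theorem ClosedAbove.exists_compose (hX : ClosedAbove I X) {m m' : Fin 7} {k : ℤ} {j j' j'' : Fin n}
    {a b : ℝ} (hm : StartsAt k m) (hm' : StartsAt (k + shift m) m')
    (h : direction m = 0 ∧ direction m' ≠ 0 ∨ direction m = 1 ∧ direction m' = 1)
    (ha : X (m, j', j) = a) (hb : X (m', j'', j') = b) :
    ∃ (z : Fin 7) (c : ℝ), StartsAt k z ∧ shift z = shift m + shift m' ∧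
      direction z = (if direction m' = 2 then 1 else direction m) ∧ X (z, j'', j) = c ∧
      a + b ≤ c := by
  obtain ⟨z, h1, h2, h3, h4⟩ := exists_composeRules hm hm' h
  have := hX.add_le (z, j'', j) (m', j'', j') (m, j', j) ⟨h1, rfl, rfl, rfl⟩
  rw [ha, hb, ← WithBot.coe_add] at this
  obtain ⟨c, hc⟩ := WithBot.ne_bot_iff_exists.1 (ne_bot_of_le_ne_bot WithBot.coe_ne_bot this)
  rw [← hc, WithBot.coe_le_coe] at this
  exact ⟨z, c, h2, h3, h4, hc.symm, by linarith⟩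

/-- An arc in front of a path in normal form. -/
theorem NormalPath.exists_cons (hX : ClosedAbove I X) {i : Fin n} {l : ℤ} {d : Fin 3} {j' : Fin n}
    {k' : ℤ} {w : ℝ} (h : NormalPath X i l d j' k' w) {m : Fin 7} {j : Fin n} {k : ℤ} {a : ℝ}
    (hm : StartsAt k m) (hk : k' = k + shift m) (ha : X (m, j', j) = a) :
    ∃ d' w', NormalPath X i l d' j k w' ∧ a + w ≤ w' := by
  induction h generalizing m j k a with
  | nil =>
    subst hk
    have hd : direction m = 0 ∨ direction m = 1 ∨ direction m = 2 := by omega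
    rcases hd with hd | hd | hd
    · exact ⟨_, _, .away hm hd ha .nil, le_rfl⟩
    · exact ⟨_, _, .level hm hd ha (by decide) .nil, le_rfl⟩
    · exact ⟨_, _, .towards hm hd ha .nil, le_rfl⟩
  | away hm1 hd1 ha1 h ih =>
    subst hk
    have hd : direction m = 0 ∨ direction m = 1 ∨ direction m = 2 := by omega
    rcases hd with hd | hd | hd
    · exact ⟨_, _, .away hm hd ha (.away hm1 hd1 ha1 h), le_rfl⟩
    · exact ⟨_, _, .level hm hd ha (by decide) (.away hm1 hd1 ha1 h), le_rfl⟩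
    · exact ⟨_, _, .towards hm hd ha (.away hm1 hd1 ha1 h), le_rfl⟩
  | level hm1 hd1 ha1 hne h ih =>
    subst hk
    have hd : direction m = 0 ∨ direction m = 1 ∨ direction m = 2 := by omega
    rcases hd with hd | hd | hd
    -- Away then level merges into an away arc, which may clash with the next arc in turn; the
    -- induction hypothesis puts it in front of the shorter tail.
    · obtain ⟨z, c, h1, h2, h3, h4, h5⟩ :=
        hX.exists_compose hm hm1 (Or.inl ⟨hd, by rw [hd1]; decide⟩) ha ha1
      obtain ⟨d', w', h6, h7⟩ := ih h1 (by rw [h2]; ring) h4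
      exact ⟨d', w', h6, by linarith⟩
    -- Two level arcs merge into one, and the tail does not start with a level arc, so the result is
    -- already normal.
    · obtain ⟨z, c, h1, h2, h3, h4, h5⟩ :=
        hX.exists_compose hm hm1 (Or.inr ⟨hd, hd1⟩) ha ha1
      rw [add_assoc, ← h2] at h
      exact ⟨_, _, .level h1 (by rw [h3, hd1, hd]; decide) h4 hne h, by linarith⟩
    · exact ⟨_, _, .towards hm hd ha (.level hm1 hd1 ha1 hne h), le_rfl⟩
  | towards hm1 hd1 ha1 h ih =>
    subst hk
    have hd : direction m = 0 ∨ direction m = 1 ∨ direction m = 2 := by omega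
    rcases hd with hd | hd | hd
    · obtain ⟨z, c, h1, h2, h3, h4, h5⟩ :=
        hX.exists_compose hm hm1 (Or.inl ⟨hd, by rw [hd1]; decide⟩) ha ha1
      obtain ⟨d', w', h6, h7⟩ := ih h1 (by rw [h2]; ring) h4
      exact ⟨d', w', h6, by linarith⟩
    · exact ⟨_, _, .level hm hd ha (by decide) (.towards hm1 hd1 ha1 h), le_rfl⟩
    · exact ⟨_, _, .towards hm hd ha (.towards hm1 hd1 ha1 h), le_rfl⟩

theorem abs_add_shift {m : Fin 7} {k : ℤ} (hm : StartsAt k m) :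
    |k + shift m| = |k| + 1 - (direction m : ℕ) := by
  fin_cases m <;> simp [StartsAt, shift, direction] at hm ⊢ <;>
    first
    | (rw [abs_of_nonpos (by omega), abs_of_nonpos (by omega)] <;> omega)
    | (rw [abs_of_nonneg (by omega), abs_of_nonneg (by omega)] <;> omega)

/-- Each arc weighs at most `b`, so it suffices to count arcs: at most `|k|` towards, `|k| + 1`
level and `|l|` away. If the first arc is not a level arc, one is saved; if it leads away or the
path is empty, only `|l| - |k|` away arcs occur. The three bounds are proved together because each
arc type relies on another bound for its tail. -/
theorem NormalPath.weight_le {b : ℝ} (hb : 0 ≤ b) (hXb : ∀ a (x : ℝ), X a = x → x ≤ b) {i : Fin n}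
    {l : ℤ} {d : Fin 3} {j : Fin n} {k : ℤ} {w : ℝ} (h : NormalPath X i l d j k w) :
    (d = 0 → w ≤ b * (|l| - |k| : ℤ)) ∧ (d ≠ 1 → w ≤ b * (|l| + 2 * |k| : ℤ)) ∧
      w ≤ b * (|l| + 2 * |k| + 1 : ℤ) := by
  have mono : ∀ {x y : ℤ}, x ≤ y → b * (x : ℝ) ≤ b * y := fun h =>
    mul_le_mul_of_nonneg_left (by exact_mod_cast h) hb
  have step : ∀ {a w : ℝ} {x y : ℤ}, a ≤ b → w ≤ b * x → x + 1 ≤ y → a + w ≤ b * y := by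
    intro a w x y ha hw hxy
    have := mono hxy
    push_cast at this
    linarith
  induction h with
  | nil =>
    have := abs_nonneg l
    refine ⟨fun _ => by simp, fun _ => ?_, ?_⟩
    · have := mono (x := 0) (y := |l| + 2 * |l|) (by omega); simpa using this
    · have := mono (x := 0) (y := |l| + 2 * |l| + 1) (by omega); simpa using this
  | @away m j j' k a w hm hd ha h ih =>
    have h1 := abs_add_shift hm
    have h2 := abs_nonneg k
    rw [hd] at h1
    simp at h1
    refine ⟨fun _ => ?_, fun _ => ?_, ?_⟩ <;>
      exact step (hXb _ _ ha) (ih.1 rfl) (by omega)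
  | @level m j j' k a w d hm hd ha hne h ih =>
    have h1 := abs_add_shift hm
    rw [hd] at h1
    simp at h1
    refine ⟨fun h => absurd h (by decide), fun h => absurd rfl h, ?_⟩
    exact step (hXb _ _ ha) (ih.2.1 hne) (by omega)
  | @towards m j j' k a w d hm hd ha h ih =>
    have h1 := abs_add_shift hm
    rw [hd] at h1
    simp at h1
    refine ⟨fun h => absurd h (by decide), fun _ => ?_, ?_⟩ <;>
      exact step (hXb _ _ ha) ih.2.2 (by omega)

theorem ClosedAbove.not_hasInfWeightPath (hX : ClosedAbove I X) :
    ¬ I.graph.HasInfWeightPath := by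
  rintro ⟨⟨j, k⟩, ⟨i, l⟩, ρ, hρ⟩
  have normal : ∀ (u v : Fin n × ℤ) (p : I.graph.Path u v),
      ∃ d w, NormalPath X v.1 v.2 d u.1 u.2 w ∧ p.weight ≤ w := by
    intro u v p
    have arc : ∀ {u v : Fin n × ℤ}, I.graph.Adj u v → ∃ (m : Fin 7) (a : ℝ),
        StartsAt u.2 m ∧ v.2 = u.2 + shift m ∧ X (m, v.1, u.1) = a ∧ I.graph.w u v ≤ a := by
      intro u v h
      obtain ⟨m, h1, h2, h3⟩ := I.exists_of_graph_adj h
      have h4 := hX.le (m, v.1, u.1)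
      rw [h3] at h4
      obtain ⟨a, ha⟩ := WithBot.ne_bot_iff_exists.1 (ne_bot_of_le_ne_bot WithBot.coe_ne_bot h4)
      rw [← ha, WithBot.coe_le_coe] at h4
      exact ⟨m, a, h1, h2, ha.symm, h4⟩
    induction p with
    | single h =>
      obtain ⟨m, a, h1, h2, h3, h4⟩ := arc h
      obtain ⟨d, w, h5, h6⟩ := NormalPath.nil.exists_cons hX h1 h2 h3
      exact ⟨d, w, h5, by simp only [WDigraph.Path.weight]; linarith⟩
    | cons h p ih =>
      obtain ⟨m, a, h1, h2, h3, h4⟩ := arc h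
      obtain ⟨d, w, h5, h6⟩ := ih
      obtain ⟨d', w', h7, h8⟩ := h5.exists_cons hX h1 h2 h3
      exact ⟨d', w', h7, by simp only [WDigraph.Path.weight]; linarith⟩
  obtain ⟨b, hb, hXb⟩ : ∃ b : ℝ, 0 ≤ b ∧ ∀ a (x : ℝ), X a = x → x ≤ b := by
    obtain ⟨b, hb⟩ := (Set.finite_range fun a => (X a).unbotD 0).bddAbove
    -- Nonnegativity makes the bound monotone in the number of arcs.
    refine ⟨max b 0, le_max_right _ _, fun a x hx => le_max_of_le_left ?_⟩
    exact hb ⟨a, by simp [hx]⟩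
  obtain ⟨N, hN⟩ := (hρ.eventually_gt_atTop (b * (|l| + 2 * |k| + 1 : ℤ))).exists
  obtain ⟨d, w, h1, h2⟩ := normal _ _ (ρ N)
  have := (h1.weight_le hb hXb).2.2
  linarith

end Graph

/-! ## Total correctness with time bounds -/

/-- Started on the store `s`, the program `c` terminates after at most `T` steps with a store that
satisfies `Q`. -/
def Terminates (c : Prog) (s : Store) (T : ℕ) (Q : Store → Prop) : Prop :=
  ∃ t ≤ T, ∃ s', Q s' ∧ ∀ K, step^[t] (c :: K, s) = (K, s')

namespace Terminates

variable {b : Test} {c d : Prog} {s : Store} {T T' : ℕ} {Q Q' : Store → Prop}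

theorem mono (h : Terminates c s T Q) (hT : T ≤ T') (hQ : ∀ s', Q s' → Q' s') :
    Terminates c s T' Q' := by
  obtain ⟨t, ht, s', hs', h⟩ := h
  exact ⟨t, ht.trans hT, s', hQ _ hs', h⟩

theorem skip (h : Q s) : Terminates .skip s 1 Q :=
  ⟨1, le_rfl, s, h, fun _ => rfl⟩

theorem instr {i : Instr} (h : Q (i.exec s)) : Terminates (.instr i) s 1 Q :=
  ⟨1, le_rfl, _, h, fun _ => rfl⟩

theorem seq (h : Terminates c s T fun s' => Terminates d s' T' Q) :
    Terminates (.seq c d) s (T + T' + 1) Q := by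
  obtain ⟨t, ht, s', ⟨t', ht', s'', h1, h2⟩, h3⟩ := h
  refine ⟨t' + t + 1, by omega, s'', h1, fun K => ?_⟩
  rw [Function.iterate_add_apply, Function.iterate_one, Function.iterate_add_apply]
  exact (congrArg _ (h3 (d :: K))).trans (h2 K)

theorem ite (h : b.Holds s → Terminates c s T Q) (h' : ¬ b.Holds s → Terminates d s T Q) :
    Terminates (.ite b c d) s (T + 1) Q := by
  by_cases hb : b.Holds s
  · obtain ⟨t, ht, s', h1, h2⟩ := h hb
    refine ⟨t + 1, by omega, s', h1, fun K => ?_⟩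
    rw [Function.iterate_add_apply, Function.iterate_one, ← h2 K]
    exact congrArg _ (if_pos hb)
  · obtain ⟨t, ht, s', h1, h2⟩ := h' hb
    refine ⟨t + 1, by omega, s', h1, fun K => ?_⟩
    rw [Function.iterate_add_apply, Function.iterate_one, ← h2 K]
    exact congrArg _ (if_neg hb)

theorem while_false (hb : ¬ b.Holds s) (h : Q s) : Terminates (.while b c) s 1 Q :=
  ⟨1, le_rfl, s, h, fun _ => if_neg hb⟩

theorem while_true (hb : b.Holds s)
    (h : Terminates c s T fun s' => Terminates (.while b c) s' T' Q) :
    Terminates (.while b c) s (T + T' + 1) Q := by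
  obtain ⟨t, ht, s', ⟨t', ht', s'', h1, h2⟩, h3⟩ := h
  refine ⟨t' + t + 1, by omega, s'', h1, fun K => ?_⟩
  rw [Function.iterate_add_apply, Function.iterate_one, Function.iterate_add_apply, ← h2 K]
  refine (congrArg (fun y => step^[t'] (step^[t] y)) (if_pos hb)).trans ?_
  exact congrArg _ (h3 _)

end Terminates

/-- Execute `c` with the values `0, …, b - 1` in the integer cell `x`, where the cell `y` holds `b`
and the cell `1` holds `1`. -/
def forLoop (x y : ℕ) (c : Prog) : Prog :=
  .seq (.instr (.natConst (.dir x) 0))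
    (.while (.natLt (.dir x) (.dir y)) (.seq c (.instr (.natOp .add (.dir x) (.dir x) (.dir 1)))))

namespace Terminates

variable {c : Prog} {s : Store} {T x y b : ℕ}

/-- Beyond the body, an iteration pays for the test, the sequencing and the increment;
initialisation, its sequencing and the final test give the last `3`. The invariant is required after
the counter has been advanced. -/
theorem forLoop_inv {Inv : ℕ → Store → Prop} (hy : ∀ i s, Inv i s → s.int y = b)
    (hbody : ∀ i < b, ∀ s, Inv i s → s.int x = i → Terminates c s T fun s' =>
      s'.int x = i ∧ s'.int 1 = 1 ∧ Inv (i + 1) (s'.setInt (.dir x) (i + 1)))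
    (h : Inv 0 (s.setInt (.dir x) 0)) :
    Terminates (forLoop x y c) s (b * (T + 3) + 3) (Inv b) := by
  have key : ∀ k i s, i + k = b → Inv i s → s.int x = i →
      Terminates (.while (.natLt (.dir x) (.dir y))
        (.seq c (.instr (.natOp .add (.dir x) (.dir x) (.dir 1))))) s (k * (T + 3) + 1) (Inv b) := by
    intro k
    induction k with
    | zero =>
      intro i s hi hs hx
      obtain rfl : i = b := hi
      refine (while_false ?_ hs).mono (by omega) fun _ h => h
      simp [Test.Holds, Operand.addr, hx, hy _ _ hs]
    | succ k ih =>
      intro i s hi hs hx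
      refine (while_true (T := T + 1 + 1) (T' := k * (T + 3) + 1) ?_ ?_).mono
        (by rw [add_mul]; omega) fun _ h => h
      · simp [Test.Holds, Operand.addr, hx, hy _ _ hs]
        omega
      · refine seq ((hbody i (by omega) s hs hx).mono le_rfl ?_)
        rintro s' ⟨h1, h2, h3⟩
        refine instr ?_
        have h4 : Instr.exec s' (.natOp .add (.dir x) (.dir x) (.dir 1)) =
            s'.setInt (.dir x) (i + 1) := by
          simp [Instr.exec, NatOp.eval, Operand.addr, h1, h2]
        rw [h4]
        exact ih _ _ (by omega) h3 (by simp [Store.setInt, Operand.addr])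
  refine (seq (T := 1) (T' := b * (T + 3) + 1) (instr ?_)).mono (by omega) fun _ h => h
  exact key b 0 _ (by omega) h (by simp [Instr.exec, Store.setInt, Operand.addr])

end Terminates

/-! ## Programs that keep numbers of polynomial size -/

/-- Instructions that write only constants up to `7`, increments, and results of operations on cells
of smaller rank to the integer cells, and use no arithmetic on the data cells but addition. -/
def Instr.Tame (rk : ℕ → ℕ) : Instr → Prop
  | .natConst (.dir x) c => c ≤ 7 ∧ (x = 1 → c = 1)
  | .natCopy (.dir x) (.dir y) => x ≠ 1 ∧ rk y ≤ rk x
  | .natOp o (.dir x) (.dir y) (.dir z) =>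
    x ≠ 1 ∧ (rk y < rk x ∧ rk z < rk x ∨ o = .add ∧ rk x = 0 ∧ y = x ∧ z = 1)
  | .realCopy _ _ => True
  | .realOp .add _ _ _ => True
  | _ => False

def Prog.Tame (rk : ℕ → ℕ) : Prog → Prop
  | .skip => True
  | .instr i => i.Tame rk
  | .seq c d => c.Tame rk ∧ d.Tame rk
  | .ite _ c d => c.Tame rk ∧ d.Tame rk
  | .while _ c => c.Tame rk

/-- An invariant of the store, indexed by time, that is kept by all tame instructions. -/
theorem tame_invariant {rk : ℕ → ℕ} {J : ℕ → Store → Prop}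
    (hJ : ∀ t s, J t s → J (t + 1) s)
    (hexec : ∀ t s (i : Instr), i.Tame rk → J t s → J (t + 1) (i.exec s))
    {c : Prog} (hc : c.Tame rk) {s : Store} (hs : J 0 s) (t : ℕ) :
    J t (step^[t] ([c], s)).2 := by
  suffices H : (∀ d ∈ (step^[t] ([c], s)).1, d.Tame rk) ∧ J t (step^[t] ([c], s)).2 from H.2
  induction t with
  | zero => simpa using ⟨hc, hs⟩
  | succ t ih =>
    rw [Function.iterate_succ_apply']
    generalize step^[t] ([c], s) = cfg at ih ⊢
    obtain ⟨K, s⟩ := cfg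
    obtain ⟨h1, h2⟩ := ih
    simp only at h1 h2
    rcases K with _ | ⟨c, K⟩
    · exact ⟨by simp [step], hJ _ _ h2⟩
    simp only [List.mem_cons, forall_eq_or_imp] at h1
    obtain ⟨h0, h1⟩ := h1
    rcases c with _ | i | ⟨c, d⟩ | ⟨b, c, d⟩ | ⟨b, c⟩
    · exact ⟨h1, hJ _ _ h2⟩
    · exact ⟨h1, hexec _ _ _ h0 h2⟩
    · exact ⟨by simpa [step] using ⟨h0.1, h0.2, h1⟩, hJ _ _ h2⟩
    · simp only [step]
      split_ifs
      · exact ⟨by simpa using ⟨h0.1, h1⟩, hJ _ _ h2⟩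
      · exact ⟨by simpa using ⟨h0.2, h1⟩, hJ _ _ h2⟩
    · simp only [step]
      split_ifs
      · exact ⟨by simpa using ⟨h0, h0, h1⟩, hJ _ _ h2⟩
      · exact ⟨h1, hJ _ _ h2⟩

/-- Cells of rank zero grow by at most one per step, since cell `1` never exceeds `1`. A sum or
product of two cells of smaller rank is at most the square of the larger bound, which doubles the
exponent once per rank. -/
theorem tame_int_le {rk : ℕ → ℕ} {c : Prog} (hc : c.Tame rk) {n : ℕ} (I : Instance ℝ n)
    (t a : ℕ) : (run c I t).2.int a ≤ (n + 7 + t) ^ 2 ^ rk a := by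
  have pow_le : ∀ (u v r : ℕ), u ≤ v → (n + 7 + u) ^ 2 ^ r ≤ (n + 7 + v) ^ 2 ^ r := fun u v r h =>
    Nat.pow_le_pow_left (by omega) _
  have le_pow : ∀ (u r : ℕ), n + 7 + u ≤ (n + 7 + u) ^ 2 ^ r := fun u r =>
    Nat.le_self_pow (by positivity) _
  refine (tame_invariant (J := fun t s => s.int 1 ≤ 1 ∧ ∀ a, s.int a ≤ (n + 7 + t) ^ 2 ^ rk a)
    ?_ ?_ hc ?_ t).2 a
  · rintro t s ⟨h1, h2⟩
    exact ⟨h1, fun a => (h2 a).trans (pow_le _ _ _ (by omega))⟩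
  · rintro t s i hi ⟨h1, h2⟩
    have set_int : ∀ (x v : ℕ), (x = 1 → v ≤ 1) → v ≤ (n + 7 + (t + 1)) ^ 2 ^ rk x →
        (s.setInt (.dir x) v).int 1 ≤ 1 ∧
          ∀ a, (s.setInt (.dir x) v).int a ≤ (n + 7 + (t + 1)) ^ 2 ^ rk a := by
      intro x v hv hvx
      simp only [Store.setInt, Operand.addr, Function.update_apply]
      refine ⟨?_, fun a => ?_⟩
      · split_ifs with h
        · exact hv h.symm
        · exact h1
      · split_ifs with h
        · exact h ▸ hvx
        · exact (h2 a).trans (pow_le _ _ _ (by omega))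
    have small : ∀ {x y : ℕ}, rk y < rk x →
        (n + 7 + (t + 1)) ^ 2 ^ rk y * (n + 7 + (t + 1)) ^ 2 ^ rk y ≤
          (n + 7 + (t + 1)) ^ 2 ^ rk x := by
      intro x y h
      rw [← pow_add, ← two_mul, ← pow_succ']
      exact Nat.pow_le_pow_right (by omega) (Nat.pow_le_pow_right (by omega) h)
    match i, hi with
    | .natConst (.dir x) c, hi =>
      exact set_int _ _ (fun h => (hi.2 h).le)
        ((by have := hi.1; omega : c ≤ n + 7 + (t + 1)).trans (le_pow _ _))
    | .natCopy (.dir x) (.dir y), hi =>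
      refine set_int _ _ (fun h => absurd h hi.1) ((h2 y).trans ?_)
      exact (pow_le _ _ _ (by omega)).trans
        (Nat.pow_le_pow_right (by omega) (Nat.pow_le_pow_right (by omega) hi.2))
    | .natOp o (.dir x) (.dir y) (.dir z), hi =>
      refine set_int _ _ (fun h => absurd h hi.1) ?_
      rcases hi.2 with ⟨h3, h4⟩ | ⟨rfl, h3, rfl, rfl⟩
      · have hy := (h2 y).trans (pow_le t (t + 1) _ (by omega))
        have hz := (h2 z).trans (pow_le t (t + 1) _ (by omega))
        have hyx := small h3
        have hzx := small h4
        have hy2 := le_pow (t + 1) (rk y)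
        have hz2 := le_pow (t + 1) (rk z)
        set Y := (n + 7 + (t + 1)) ^ 2 ^ rk y
        set Z := (n + 7 + (t + 1)) ^ 2 ^ rk z
        change o.eval (s.int y) (s.int z) ≤ _
        have hYY : 2 * Y ≤ Y * Y := Nat.mul_le_mul_right _ (by omega)
        have hZZ : 2 * Z ≤ Z * Z := Nat.mul_le_mul_right _ (by omega)
        cases o with
        | add => simp only [NatOp.eval]; omega
        | sub => simp only [NatOp.eval]; omega
        | mul =>
          simp only [NatOp.eval]
          rcases le_total Y Z with h | h
          · exact (Nat.mul_le_mul (hy.trans h) hz).trans hzx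
          · exact (Nat.mul_le_mul hy (hz.trans h)).trans hyx
      · have := h2 y
        simp only [h3, pow_zero, pow_one] at this ⊢
        simp only [NatOp.eval, Operand.addr]
        omega
    | .realCopy x y, hi => exact ⟨h1, fun a => (h2 a).trans (pow_le _ _ _ (by omega))⟩
    | .realOp o x y z, hi => exact ⟨h1, fun a => (h2 a).trans (pow_le _ _ _ (by omega))⟩
  · refine ⟨by simp [inputStore], fun a => ?_⟩
    refine le_trans ?_ (le_pow 0 (rk a))
    simp only [inputStore]
    split_ifs <;> omega

/-! ### Encoding lengths of the data. -/

/-- The element `-∞`, or a fraction with denominator `D` and a numerator of absolute value at most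
`B`. -/
def FractionLE (D B : ℕ) (x : WithBot ℝ) : Prop :=
  x = ⊥ ∨ ∃ z : ℤ, x = ((z / D : ℚ) : ℝ) ∧ z.natAbs ≤ B

theorem FractionLE.mono {D B B' : ℕ} {x : WithBot ℝ} (h : FractionLE D B x) (hB : B ≤ B') :
    FractionLE D B' x := by
  rcases h with h | ⟨z, h1, h2⟩
  · exact Or.inl h
  · exact Or.inr ⟨z, h1, h2.trans hB⟩

/-- Addition keeps a common denominator and at most doubles the bound on the numerators, so `t`
steps add at most `t` bits. -/
theorem tame_fractionLE {rk : ℕ → ℕ} {c : Prog} (hc : c.Tame rk) {s : Store} {D B : ℕ}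
    (hs : ∀ a, FractionLE D B (s.num a)) (t a : ℕ) :
    FractionLE D (2 ^ t * B) ((step^[t] ([c], s)).2.num a) := by
  have double : ∀ t : ℕ, 2 ^ (t + 1) * B = 2 ^ t * B + 2 ^ t * B := fun t => by ring
  refine tame_invariant (J := fun t s => ∀ a, FractionLE D (2 ^ t * B) (s.num a)) ?_ ?_ hc
    (by simpa using hs) t a
  · intro t s h a
    exact (h a).mono (by rw [double]; omega)
  · intro t s i hi h
    have set_num : ∀ (x : Operand) (v : WithBot ℝ), FractionLE D (2 ^ (t + 1) * B) v →
        ∀ a, FractionLE D (2 ^ (t + 1) * B) ((s.setNum x v).num a) := by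
      intro x v hv a
      simp only [Store.setNum, Function.update_apply]
      split_ifs
      · exact hv
      · exact (h a).mono (by rw [double]; omega)
    match i, hi with
    | .natConst x c, hi => exact fun a => (h a).mono (by rw [double]; omega)
    | .natCopy x y, hi => exact fun a => (h a).mono (by rw [double]; omega)
    | .natOp o x y z, hi => exact fun a => (h a).mono (by rw [double]; omega)
    | .realCopy x y, hi => exact set_num _ _ ((h _).mono (by rw [double]; omega))
    | .realOp .add x y z, hi =>
      refine set_num _ _ ?_
      rcases h (y.addr s) with h1 | ⟨u, h1, h2⟩
      · exact Or.inl (by rw [h1]; rfl)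
      rcases h (z.addr s) with h3 | ⟨v, h3, h4⟩
      · exact Or.inl (by rw [h1, h3]; rfl)
      refine Or.inr ⟨u + v, ?_, ?_⟩
      · rw [h1, h3]
        refine congrArg WithBot.some ?_
        push_cast
        ring
      · have := Int.natAbs_add_le u v
        rw [double]
        omega

theorem encLen_pos (q : WithBot ℚ) : 1 ≤ encLen q := by
  cases q with
  | bot => exact le_rfl
  | coe q => simp only [encLen]; omega

/-- Reducing the fraction shrinks both numerator and denominator; the `3` is the sign and one extra
digit for each. -/
theorem FractionLE.exists_encLen_le {D L : ℕ} (hD : D ≠ 0) {x : WithBot ℝ} {E : ℕ}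
    (hDE : D ≤ 2 ^ E) (h : FractionLE D (2 ^ L) x) :
    ∃ q : WithBot ℚ, x = q.map (fun r : ℚ => (r : ℝ)) ∧ encLen q ≤ L + E + 3 := by
  rcases h with rfl | ⟨z, rfl, hz⟩
  · exact ⟨⊥, rfl, by simp only [encLen]; omega⟩
  refine ⟨((z / D : ℚ) : WithBot ℚ), rfl, ?_⟩
  have h1 : (z / D : ℚ).den ≤ D := by
    have := Rat.den_dvd z D
    exact Nat.le_of_dvd (Nat.pos_of_ne_zero hD) (by exact_mod_cast this)
  have h2 : (z / D : ℚ).num.natAbs ≤ z.natAbs := by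
    rcases eq_or_ne z 0 with rfl | hz0
    · simp
    have := Rat.num_dvd z (b := (D : ℤ)) (by exact_mod_cast hD)
    rw [Rat.divInt_eq_div] at this
    exact Nat.le_of_dvd (Int.natAbs_pos.2 hz0) (Int.natAbs_dvd_natAbs.2 (by exact_mod_cast this))
  have h3 : Nat.size (z / D : ℚ).num.natAbs ≤ L + 1 :=
    Nat.size_le.2 (by rw [pow_succ]; have := Nat.two_pow_pos L; omega)
  have h4 : Nat.size (z / D : ℚ).den ≤ E + 1 :=
    Nat.size_le.2 (by rw [pow_succ]; have := Nat.two_pow_pos E; omega)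
  simp only [encLen]
  omega

theorem Instance.encLen_eq {n : ℕ} (I : Instance ℚ n) :
    I.encLen = ∑ a : Entry n, UltimatePath.encLen (I.entry a) := by
  simp only [Instance.encLen, Instance.entry, Fintype.sum_prod_type]

theorem Instance.le_encLen {n : ℕ} (I : Instance ℚ n) : n ≤ I.encLen := by
  rw [I.encLen_eq]
  calc n ≤ ∑ _a : Entry n, 1 := by simp; nlinarith [Nat.le_mul_self n]
    _ ≤ _ := Finset.sum_le_sum fun a _ => encLen_pos _

theorem Instance.entry_map {α β : Type} {n : ℕ} (f : α → β) (I : Instance α n) (a : Entry n) :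
    (I.map f).entry a = (I.entry a).map f := by
  obtain ⟨m, i, j⟩ := a
  fin_cases m <;> rfl

def address {n : ℕ} (a : Entry n) : ℕ := (finProdFinEquiv (a.1, finProdFinEquiv a.2)).val

theorem address_eq {n : ℕ} (m : Fin 7) (i j : Fin n) :
    address (m, i, j) = m * (n * n) + i * n + j := by
  simp only [address, finProdFinEquiv_apply_val]
  ring

theorem address_lt {n : ℕ} (a : Entry n) : address a < 7 * (n * n) := Fin.is_lt _

theorem address_inj {n : ℕ} {a b : Entry n} : address a = address b ↔ a = b := by
  refine ⟨fun h => ?_, fun h => h ▸ rfl⟩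
  have := finProdFinEquiv.injective (Fin.ext h)
  rw [Prod.mk.injEq] at this
  exact Prod.ext this.1 (finProdFinEquiv.injective this.2)

theorem inputStore_num_address {n : ℕ} (I : Instance ℝ n) (a : Entry n) :
    (inputStore I).num (address a) = I.entry a := by
  refine (dif_pos (address_lt a)).trans ?_
  simp only [address, Fin.eta, Equiv.symm_apply_apply, Instance.entry]

theorem inputStore_num_eq {n : ℕ} (I : Instance ℝ n) (x : ℕ) :
    (inputStore I).num x = 0 ∨ ∃ a, (inputStore I).num x = I.entry a := by
  simp only [inputStore]
  split_ifs with h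
  · exact Or.inr ⟨(_, _, _), rfl⟩
  · exact Or.inl rfl

/-- A common denominator of all entries. -/
theorem exists_fractionLE {n : ℕ} (I : Instance ℚ n) : ∃ D : ℕ, D ≠ 0 ∧ D ≤ 2 ^ I.encLen ∧
    ∀ x, FractionLE D (2 ^ (2 * I.encLen))
      ((inputStore (I.map fun q : ℚ => (q : ℝ))).num x) := by
  let den : WithBot ℚ → ℕ := fun q => (q.map Rat.den).unbotD 1
  have den_pos : ∀ q, den q ≠ 0 := by
    intro q
    cases q with
    | bot => exact one_ne_zero
    | coe q => exact q.den_nz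
  have den_le : ∀ q, den q ≤ 2 ^ UltimatePath.encLen q := by
    intro q
    cases q with
    | bot => exact Nat.one_le_two_pow
    | coe q =>
      change q.den ≤ _
      exact (Nat.lt_size_self _).le.trans
        (Nat.pow_le_pow_right (by omega) (by simp only [UltimatePath.encLen]; omega))
  have hD : ∏ a, den (I.entry a) ≤ 2 ^ I.encLen := by
    rw [I.encLen_eq, ← Finset.prod_pow_eq_pow_sum]
    exact Finset.prod_le_prod' fun a _ => den_le _
  refine ⟨∏ a, den (I.entry a), Finset.prod_ne_zero_iff.2 fun a _ => den_pos _, hD, fun x => ?_⟩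
  have hD0 : (∏ a, den (I.entry a)) ≠ 0 := Finset.prod_ne_zero_iff.2 fun a _ => den_pos _
  rcases inputStore_num_eq (I.map fun q : ℚ => (q : ℝ)) x with h | ⟨a, h⟩
  · exact Or.inr ⟨0, by rw [h]; simp, by simp⟩
  rw [h, Instance.entry_map]
  have hdvd : den (I.entry a) ∣ ∏ a, den (I.entry a) := Finset.dvd_prod_of_mem _ (Finset.mem_univ a)
  have hle : UltimatePath.encLen (I.entry a) ≤ I.encLen := by
    rw [I.encLen_eq]
    exact Finset.single_le_sum (f := fun a => UltimatePath.encLen (I.entry a))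
      (fun _ _ => Nat.zero_le _) (Finset.mem_univ a)
  generalize (∏ a, den (I.entry a)) = D at hD hD0 hdvd
  cases hq : I.entry a with
  | bot => exact Or.inl rfl
  | coe q =>
    rw [hq] at hdvd hle
    obtain ⟨e, rfl⟩ : q.den ∣ D := hdvd
    -- Extending to the denominator `D` multiplies the numerator by a cofactor `e ≤ D`, hence the
    -- exponent `2 * I.encLen`.
    refine Or.inr ⟨q.num * e, ?_, ?_⟩
    · have he : (e : ℚ) ≠ 0 := by
        rintro h
        rw [Nat.cast_eq_zero.1 h] at hD0
        simp at hD0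
      refine congrArg (fun r : ℚ => ((r : ℝ) : WithBot ℝ)) ?_
      push_cast
      rw [mul_div_mul_right _ _ he, Rat.num_div_den]
    · rw [Int.natAbs_mul, Int.natAbs_natCast, two_mul, pow_add]
      refine Nat.mul_le_mul ?_ ((Nat.le_mul_of_pos_left e q.den_pos).trans hD)
      refine (Nat.lt_size_self _).le.trans (Nat.pow_le_pow_right (by omega) (le_trans ?_ hle))
      simp only [UltimatePath.encLen]
      omega

theorem run_eq_of_halted {c : Prog} {n : ℕ} {I : Instance ℝ n} {t t' : ℕ}
    (h : (run c I t).1 = []) (ht : t ≤ t') : run c I t' = run c I t := by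
  obtain ⟨d, rfl⟩ := Nat.exists_eq_add_of_le' ht
  have : run c I t = ([], (run c I t).2) := Prod.ext h rfl
  induction d with
  | zero => simp
  | succ d ih =>
    have h1 : run c I (d + 1 + t) = step (run c I (d + t)) := by
      simp only [run]
      rw [show d + 1 + t = (d + t) + 1 by ring, Function.iterate_succ_apply']
    rw [h1, ih (by omega), this]
    rfl

/-- A halted machine no longer changes, so the bounds in terms of time need only be evaluated up to
`K * n ^ d`. The term `3 * X` accounts for the initial numerators (twice `I.encLen`) and the common
denominator (once). -/
theorem tame_polynomiallyBoundedNumbers {rk : ℕ → ℕ} {c : Prog} (hc : c.Tame rk) {r : ℕ}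
    (hr : ∀ a, rk a ≤ r) {Q : (n : ℕ) → Instance ℝ n → Prop} {K d : ℕ}
    (h : DecidesInTime c Q fun n => K * n ^ d) : PolynomiallyBoundedNumbers c := by
  have early : ∀ n : ℕ, 1 ≤ n → ∀ (I : Instance ℝ n) (t : ℕ),
      ∃ t' ≤ K * n ^ d, run c I t = run c I t' := by
    intro n hn I t
    obtain ⟨t₀, h1, h2, -⟩ := h n hn I
    rcases le_total t t₀ with ht | ht
    · exact ⟨t, ht.trans h1, rfl⟩
    · exact ⟨t₀, h1, run_eq_of_halted h2 ht⟩
  constructor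
  · refine ⟨(Polynomial.X + 7 + Polynomial.C K * Polynomial.X ^ d) ^ 2 ^ r, fun n hn I t a => ?_⟩
    obtain ⟨t', h1, h2⟩ := early n hn I t
    rw [h2]
    refine (tame_int_le hc I t' a).trans ?_
    simp only [Polynomial.eval_pow, Polynomial.eval_add, Polynomial.eval_X, Polynomial.eval_mul,
      Polynomial.eval_C, Polynomial.eval_ofNat]
    exact (Nat.pow_le_pow_left (by omega) _).trans
      (Nat.pow_le_pow_right (by omega) (Nat.pow_le_pow_right (by omega) (hr a)))
  · refine ⟨Polynomial.C K * Polynomial.X ^ d + 3 * Polynomial.X + 3, fun n hn I t a => ?_⟩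
    obtain ⟨t', h1, h2⟩ := early n hn (I.map fun q : ℚ => (q : ℝ)) t
    rw [h2]
    obtain ⟨D, hD0, hDE, hD⟩ := exists_fractionLE I
    have h3 := tame_fractionLE hc hD t' a
    rw [← pow_add] at h3
    obtain ⟨q, hq1, hq2⟩ := h3.exists_encLen_le hD0 hDE
    refine ⟨q, hq1, hq2.trans ?_⟩
    simp only [Polynomial.eval_pow, Polynomial.eval_add, Polynomial.eval_X, Polynomial.eval_mul,
      Polynomial.eval_C, Polynomial.eval_ofNat]
    have h4 : K * n ^ d ≤ K * I.encLen ^ d :=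
      Nat.mul_le_mul_left _ (Nat.pow_le_pow_left I.le_encLen _)
    omega

/-! ## The program -/

def block (l : List Instr) : Prog := l.foldr (fun i c => .seq (.instr i) c) .skip

theorem Terminates.block {l : List Instr} {s : Store} {Q : Store → Prop}
    (h : Q (l.foldl Instr.exec s)) : Terminates (block l) s (2 * l.length + 1) Q := by
  induction l generalizing s with
  | nil => exact Terminates.skip h
  | cons i l ih =>
    exact (Terminates.seq (Terminates.instr (ih h))).mono (by simp only [List.length_cons]; omega)
      fun _ h => h

/-- Write the address of the entry of the `m`-th matrix whose indices are in the integer cells `x`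
and `y` to the integer cell `d`. -/
def loadAddress (d m x y : ℕ) : List Instr :=
  [.natConst (.dir 12) m, .natOp .mul (.dir 13) (.dir 12) (.dir 2),
    .natOp .mul (.dir 14) (.dir x) (.dir 0), .natOp .add (.dir 15) (.dir 13) (.dir 14),
    .natOp .add (.dir d) (.dir 15) (.dir y)]

theorem loadAddress_spec {d m x y : ℕ} (hx : x < 8) (hy : y < 8) (s : Store) :
    let s' := (loadAddress d m x y).foldl Instr.exec s
    s'.num = s.num ∧ s'.int d = m * s.int 2 + s.int x * s.int 0 + s.int y ∧
      ∀ a < 12, a ≠ d → s'.int a = s.int a := by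
  have hx12 : x ≠ 12 := by omega
  have hx13 : x ≠ 13 := by omega
  have hy12 : y ≠ 12 := by omega
  have hy13 : y ≠ 13 := by omega
  have hy14 : y ≠ 14 := by omega
  have hy15 : y ≠ 15 := by omega
  refine ⟨rfl, ?_, fun a ha had => ?_⟩
  · simp [loadAddress, Instr.exec, Store.setInt, Operand.addr, NatOp.eval, *]
  · have h12 : a ≠ 12 := by omega
    have h13 : a ≠ 13 := by omega
    have h14 : a ≠ 14 := by omega
    have h15 : a ≠ 15 := by omega
    simp [loadAddress, Instr.exec, Store.setInt, Operand.addr, NatOp.eval, *]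

/-- Replace the entry `(i, j)` of the `z`-th matrix by the sum of the entries `(i, k)` of the `u`-th
and `(k, j)` of the `v`-th matrix if this sum is larger, and set the flag in the integer cell `11`
in this case. The integer cells `5`, `6` and `7` hold `i`, `j` and `k`. -/
def relaxEntry (r : Fin 7 × Fin 7 × Fin 7) : Prog :=
  .seq (block (loadAddress 8 r.1 5 6 ++ loadAddress 9 r.2.1 5 7 ++ loadAddress 10 r.2.2 7 6 ++
      -- Cell `3` holds `7n²`, the address of the first data cell behind the matrices, which serves
      -- as scratch space.
      [.realOp .add (.ind 3) (.ind 9) (.ind 10)]))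
    (.ite (.realLt (.ind 8) (.ind 3))
      (block [.realCopy (.ind 8) (.ind 3), .natConst (.dir 11) 1]) .skip)

def relaxMatrix (r : Fin 7 × Fin 7 × Fin 7) : Prog :=
  forLoop 5 0 (forLoop 6 0 (forLoop 7 0 (relaxEntry r)))

/-- The relaxations for all the rules, with the flag reset before. -/
def relaxRound : Prog :=
  .seq (.instr (.natConst (.dir 11) 0))
    (composeRules.foldr (fun r c => .seq (relaxMatrix r) c) .skip)

/-- As many rounds as there are matrix entries. The answer is whether the last one changed
anything. -/
def decisionProgram : Prog :=
  .seq (block [.natConst (.dir 1) 1, .natOp .mul (.dir 2) (.dir 0) (.dir 0),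
      .natConst (.dir 12) 7, .natOp .mul (.dir 3) (.dir 12) (.dir 2)])
    (.seq (forLoop 4 3 relaxRound) (.instr (.natCopy (.dir 0) (.dir 11))))

/-- Ranks of the integer cells, for `Instr.Tame`. -/
def cellRank (a : ℕ) : ℕ :=
  -- Counters, the flag and small constants have rank 0; cells `2` and `3` hold `n²` and `7n²`;
  -- cells `13` to `15` are intermediate results for the addresses in `8` to `10`.
  if a ≤ 1 then 0 else if a = 2 then 1 else if a = 3 then 2 else if a ≤ 7 then 0
  else if a ≤ 10 then 4 else if a ≤ 12 then 0 else if a = 13 then 2 else if a = 14 then 1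
  else if a = 15 then 3 else 0

theorem decisionProgram_tame : decisionProgram.Tame cellRank := by
  have h : ∀ r : Fin 7 × Fin 7 × Fin 7, (relaxEntry r).Tame cellRank := by
    rintro ⟨z, u, v⟩
    have hz := z.isLt.le
    have hu := u.isLt.le
    have hv := v.isLt.le
    simp [hz, hu, hv, relaxEntry, block, loadAddress, Prog.Tame, Instr.Tame, cellRank]
  simp [decisionProgram, relaxRound, composeRules, relaxMatrix, forLoop, block, Prog.Tame,
    Instr.Tame, cellRank, h]

/-! ## Correctness of the program -/

variable {n : ℕ}

def Store.entry (s : Store) (a : Entry n) : WithBot ℝ := s.num (address a)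

theorem relaxEntry_terminates {s : Store} (h0 : s.int 0 = n) (h2 : s.int 2 = n * n)
    (h3 : s.int 3 = 7 * (n * n)) {i j k : Fin n} (h5 : s.int 5 = i) (h6 : s.int 6 = j)
    (h7 : s.int 7 = k) (r : Fin 7 × Fin 7 × Fin 7) :
    Terminates (relaxEntry r) s 40 fun s' => (∀ a < 8, s'.int a = s.int a) ∧
      (s'.int 11 = s.int 11 ∧ (∀ a : Entry n, s'.entry a = s.entry a) ∧
          s.entry (r.2.1, i, k) + s.entry (r.2.2, k, j) ≤ s.entry (r.1, i, j) ∨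
        s'.int 11 = 1 ∧ s.entry (r.1, i, j) < s.entry (r.2.1, i, k) + s.entry (r.2.2, k, j) ∧
          ∀ a : Entry n, s'.entry a = if a = (r.1, i, j) then
            s.entry (r.2.1, i, k) + s.entry (r.2.2, k, j) else s.entry a) := by
  obtain ⟨z, u, v⟩ := r
  -- The block of sixteen instructions takes `33` steps, the conditional `6`, the sequencing one.
  refine (Terminates.seq (T' := 6) (Terminates.block ?_)).mono
    (by simp [loadAddress]) fun _ h => h
  simp only [List.foldl_append]
  obtain ⟨hn1, hd1, hf1⟩ := loadAddress_spec (d := 8) (m := z) (x := 5) (y := 6)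
    (by norm_num) (by norm_num) s
  set s1 := (loadAddress 8 z 5 6).foldl Instr.exec s
  obtain ⟨hn2, hd2, hf2⟩ := loadAddress_spec (d := 9) (m := u) (x := 5) (y := 7)
    (by norm_num) (by norm_num) s1
  set s2 := (loadAddress 9 u 5 7).foldl Instr.exec s1
  obtain ⟨hn3, hd3, hf3⟩ := loadAddress_spec (d := 10) (m := v) (x := 7) (y := 6)
    (by norm_num) (by norm_num) s2
  set s3 := (loadAddress 10 v 7 6).foldl Instr.exec s2
  have hf : ∀ a < 12, a ≠ 8 → a ≠ 9 → a ≠ 10 → s3.int a = s.int a := fun a h h' h'' h''' => by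
    rw [hf3 a h h''', hf2 a h h'', hf1 a h h']
  have hnum : s3.num = s.num := by rw [hn3, hn2, hn1]
  have e8 : s3.int 8 = address (z, i, j) := by
    rw [hf3 8 (by norm_num) (by norm_num), hf2 8 (by norm_num) (by norm_num), hd1, h0, h2, h5, h6,
      address_eq]
  have e9 : s3.int 9 = address (u, i, k) := by
    rw [hf3 9 (by norm_num) (by norm_num), hd2, hf1 2 (by norm_num) (by norm_num),
      hf1 5 (by norm_num) (by norm_num), hf1 0 (by norm_num) (by norm_num),
      hf1 7 (by norm_num) (by norm_num), h0, h2, h5, h7, address_eq]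
  have e10 : s3.int 10 = address (v, k, j) := by
    rw [hd3, hf2 2 (by norm_num) (by norm_num), hf1 2 (by norm_num) (by norm_num),
      hf2 7 (by norm_num) (by norm_num), hf1 7 (by norm_num) (by norm_num),
      hf2 0 (by norm_num) (by norm_num), hf1 0 (by norm_num) (by norm_num),
      hf2 6 (by norm_num) (by norm_num), hf1 6 (by norm_num) (by norm_num),
      h0, h2, h6, h7, address_eq]
  have e3 : s3.int 3 = 7 * (n * n) := by
    rw [hf 3 (by norm_num) (by norm_num) (by norm_num) (by norm_num), h3]
  have e4 : [Instr.realOp .add (.ind 3) (.ind 9) (.ind 10)].foldl Instr.exec s3 =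
      ⟨s3.int, Function.update s3.num (7 * (n * n)) (s.entry (u, i, k) + s.entry (v, k, j))⟩ := by
    simp only [List.foldl_cons, List.foldl_nil, Instr.exec, Store.setNum, Operand.addr, e3, e9, e10,
      hnum]
    rfl
  rw [e4]
  have hne : ∀ a : Entry n, address a ≠ 7 * (n * n) := fun a => (address_lt a).ne
  have hlt : Test.Holds ⟨s3.int, Function.update s3.num (7 * (n * n))
      (s.entry (u, i, k) + s.entry (v, k, j))⟩ (.realLt (.ind 8) (.ind 3)) ↔
      s.entry (z, i, j) < s.entry (u, i, k) + s.entry (v, k, j) := by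
    simp [Test.Holds, Operand.addr, e8, e3, hne, hnum, Store.entry]
  refine Terminates.ite (T := 5) (fun hb => ?_) (fun hb => ?_)
  · rw [hlt] at hb
    refine Terminates.block ⟨fun a ha => ?_, Or.inr ⟨?_, hb, fun a => ?_⟩⟩
    · have h11 : a ≠ 11 := by omega
      simp [Instr.exec, Store.setNum, Store.setInt, Operand.addr, h11]
      exact hf a (by omega) (by omega) (by omega) (by omega)
    · simp [Instr.exec, Store.setNum, Store.setInt, Operand.addr]
    · simp [Instr.exec, Store.setNum, Store.setInt, Operand.addr, e8, e3, hnum, Store.entry,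
        Function.update_apply, hne, address_inj]
  · rw [hlt] at hb
    refine (Terminates.skip ⟨fun a ha => ?_, Or.inl ⟨?_, fun a => ?_, not_lt.1 hb⟩⟩).mono
      (by norm_num) fun _ h => h
    · exact hf a (by omega) (by omega) (by omega) (by omega)
    · exact hf 11 (by norm_num) (by norm_num) (by norm_num) (by norm_num)
    · simp [Store.entry, hnum, hne]

/-- From each store that satisfies `P`, the program `c` terminates in time `T`, does not decrease
any matrix entry, and establishes `P` and the property `φ` of the matrix entries. -/
def Establishes (c : Prog) (T : ℕ) (P : Store → Prop) (φ : (Entry n → WithBot ℝ) → Prop) : Prop :=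
  ∀ s, P s → Terminates c s T fun s' =>
    P s' ∧ (s.entry : Entry n → WithBot ℝ) ≤ s'.entry ∧ φ s'.entry

/-- Entries never decrease, so a monotone property secured in one pass survives all later ones. -/
theorem Establishes.forLoop {c : Prog} {T x y b : ℕ} {P : Store → Prop}
    {φ : ℕ → (Entry n → WithBot ℝ) → Prop} (hφ : ∀ i, Monotone (φ i))
    (hP : ∀ s, P s → s.int y = b ∧ s.int 1 = 1) (hset : ∀ s v, P s → P (s.setInt (.dir x) v))
    (hc : ∀ i < b, Establishes c T (fun s => P s ∧ s.int x = i) (φ i)) :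
    Establishes (forLoop x y c) (b * (T + 3) + 3) P fun X => ∀ i < b, φ i X := by
  intro s hs
  refine (Terminates.forLoop_inv (Inv := fun i s' => P s' ∧
    (s.entry : Entry n → WithBot ℝ) ≤ s'.entry ∧ ∀ l < i, φ l s'.entry)
    (fun i s' h => (hP s' h.1).1) ?_ ⟨hset _ _ hs, fun a => le_rfl, by simp⟩).mono le_rfl
    fun _ h => h
  rintro i hi s' ⟨h1, h2, h3⟩ h4
  refine (hc i hi s' ⟨h1, h4⟩).mono le_rfl ?_
  rintro s'' ⟨⟨h5, h6⟩, h7, h8⟩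
  refine ⟨h6, (hP _ h5).2, hset _ _ h5, fun a => (h2 a).trans (h7 a), fun l hl => ?_⟩
  rcases Nat.lt_succ_iff_lt_or_eq.1 hl with hl | rfl
  · exact hφ l h7 (h3 l hl)
  · exact h8

theorem Establishes.seq {c d : Prog} {T T' : ℕ} {P : Store → Prop}
    {φ ψ : (Entry n → WithBot ℝ) → Prop} (hφ : Monotone φ) (hc : Establishes c T P φ)
    (hd : Establishes d T' P ψ) : Establishes (.seq c d) (T + T' + 1) P fun X => φ X ∧ ψ X := by
  intro s hs
  refine Terminates.seq ((hc s hs).mono le_rfl ?_)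
  rintro s' ⟨h1, h2, h3⟩
  refine (hd s' h1).mono le_rfl ?_
  rintro s'' ⟨h4, h5, h6⟩
  exact ⟨h4, h2.trans h5, hφ h5 h3, h6⟩

/-! ### Invariants of a single round. -/

variable (I : Instance ℝ n)

/-- The constants that the program has in its memory, and the fact that all matrix entries are
weights of derivation trees. -/
structure Sound (s : Store) : Prop where
  int_zero : s.int 0 = n
  int_one : s.int 1 = 1
  int_two : s.int 2 = n * n
  int_three : s.int 3 = 7 * (n * n)
  exists_tree : ∀ (a : Entry n) (x : ℝ), s.entry a = x →
    ∃ t : DTree (Entry n), t.IsDer Compose I.entry ∧ t.root = a ∧ t.weight I.entry = x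

/-- The invariant of the `r`-th round, which starts with the matrix entries `X`. -/
structure RoundInv (X : Entry n → WithBot ℝ) (r : ℕ) (s : Store) : Prop extends Sound I s where
  int_four : s.int 4 = r
  le : ∀ a, X a ≤ s.entry a
  flag : s.int 11 = 0 ∧ (∀ a, s.entry a = X a) ∨ s.int 11 = 1 ∧
    ∃ t : DTree (Entry n), t.IsDer Compose I.entry ∧ X t.root < (t.weight I.entry : ℝ)

variable {I} {X : Entry n → WithBot ℝ} {r : ℕ}

theorem Sound.setInt {s : Store} (h : Sound I s) {x : ℕ} (hx : 3 < x) (v : ℕ) :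
    Sound I (s.setInt (.dir x) v) := by
  have h0 : (0 : ℕ) ≠ x := by omega
  have h1 : (1 : ℕ) ≠ x := by omega
  have h2 : (2 : ℕ) ≠ x := by omega
  have h3 : (3 : ℕ) ≠ x := by omega
  refine ⟨?_, ?_, ?_, ?_, h.exists_tree⟩ <;>
    simp [Store.setInt, Operand.addr, *, h.int_zero, h.int_one, h.int_two,
      h.int_three]

theorem RoundInv.setInt {s : Store} (h : RoundInv I X r s) {x : ℕ} (hx : 4 < x) (hx' : x ≠ 11)
    (v : ℕ) : RoundInv I X r (s.setInt (.dir x) v) := by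
  have h4 : (4 : ℕ) ≠ x := by omega
  refine ⟨h.toSound.setInt (by omega) v, ?_, h.le, ?_⟩
  · simp [Store.setInt, Operand.addr, h4, h.int_four]
  · have h11 : (s.setInt (.dir x) v).int 11 = s.int 11 := by
      simp [Store.setInt, Operand.addr, hx'.symm]
    rw [h11]
    exact h.flag

/-- `X` is the state at the start of the round. Updates happen in place, so the summands may have
grown already, which only strengthens the inequality against `X`. -/
theorem relaxEntry_establishes {R : Fin 7 × Fin 7 × Fin 7} (hR : R ∈ composeRules)
    (i j k : Fin n) :
    Establishes (relaxEntry R) 40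
      (fun s => ((RoundInv I X r s ∧ s.int 5 = i) ∧ s.int 6 = j) ∧ s.int 7 = k)
      (fun Y => X (R.2.1, i, k) + X (R.2.2, k, j) ≤ Y (R.1, i, j)) := by
  rintro s ⟨⟨⟨h, h5⟩, h6⟩, h7⟩
  refine (relaxEntry_terminates h.int_zero h.int_two h.int_three h5 h6 h7 R).mono le_rfl ?_
  rintro s' ⟨hf, hs'⟩
  have hX : X (R.2.1, i, k) + X (R.2.2, k, j) ≤
      s.entry (R.2.1, i, k) + s.entry (R.2.2, k, j) := add_le_add (h.le _) (h.le _)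
  have e0 := (hf 0 (by norm_num)).trans h.int_zero
  have e1 := (hf 1 (by norm_num)).trans h.int_one
  have e2 := (hf 2 (by norm_num)).trans h.int_two
  have e3 := (hf 3 (by norm_num)).trans h.int_three
  have e4 := (hf 4 (by norm_num)).trans h.int_four
  have e5 := (hf 5 (by norm_num)).trans h5
  have e6 := (hf 6 (by norm_num)).trans h6
  have e7 := (hf 7 (by norm_num)).trans h7
  rcases hs' with ⟨g1, g2, g3⟩ | ⟨g1, g2, g3⟩
  · refine ⟨⟨⟨⟨⟨⟨e0, e1, e2, e3, fun a x hx => h.exists_tree a x (g2 a ▸ hx)⟩, e4,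
      fun a => g2 a ▸ h.le a, ?_⟩, e5⟩, e6⟩, e7⟩, fun a => (g2 a).ge, ?_⟩
    · rw [g1]
      exact h.flag.imp_left fun h => ⟨h.1, fun a => (g2 a).trans (h.2 a)⟩
    · change _ ≤ s'.entry _
      rw [g2]
      exact hX.trans g3
  · have hle : ∀ a : Entry n, s.entry a ≤ s'.entry a := by
      intro a
      rw [g3]
      split_ifs with ha
      · exact ha ▸ g2.le
      · exact le_rfl
    obtain ⟨y, hy⟩ := WithBot.ne_bot_iff_exists.1 (ne_bot_of_gt g2)
    obtain ⟨hu, hv⟩ := WithBot.add_ne_bot.1 (ne_bot_of_gt g2)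
    obtain ⟨p, hp⟩ := WithBot.ne_bot_iff_exists.1 hu
    obtain ⟨q, hq⟩ := WithBot.ne_bot_iff_exists.1 hv
    obtain ⟨tu, hu1, hu2, hu3⟩ := h.exists_tree _ _ hp.symm
    obtain ⟨tv, hv1, hv2, hv3⟩ := h.exists_tree _ _ hq.symm
    -- This tree serves twice: it justifies the new entry, and it witnesses that the flag was set
    -- rightly.
    have ht : (DTree.node (R.1, i, j) tu tv).IsDer Compose I.entry := by
      refine ⟨?_, hu1, hv1⟩
      rw [hu2, hv2]
      exact ⟨hR, rfl, rfl, rfl⟩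
    have hw : ((DTree.node (R.1, i, j) tu tv).weight I.entry : WithBot ℝ) =
        s.entry (R.2.1, i, k) + s.entry (R.2.2, k, j) := by
      rw [← hp, ← hq, ← WithBot.coe_add, DTree.weight, hu3, hv3]
    refine ⟨⟨⟨⟨⟨⟨e0, e1, e2, e3, fun a x hx => ?_⟩, e4, fun a => (h.le a).trans (hle a),
      Or.inr ⟨g1, _, ht, ?_⟩⟩, e5⟩, e6⟩, e7⟩, hle, ?_⟩
    · rw [g3] at hx
      split_ifs at hx with ha
      · exact ⟨_, ht, ha.symm, WithBot.coe_injective (hw.trans hx)⟩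
      · exact h.exists_tree a x hx
    · rw [hw]
      exact (h.le _).trans_lt g2
    · change _ ≤ s'.entry _
      rw [g3, if_pos rfl]
      exact hX

/-- The loop rule wants properties indexed by all natural numbers; quantifying over the proofs `hi`,
`hj`, `hk` makes the indices in `Fin n` meaningful for every counter value. -/
theorem relaxMatrix_establishes {R : Fin 7 × Fin 7 × Fin 7} (hR : R ∈ composeRules) :
    Establishes (relaxMatrix R) (n * (n * (n * 43 + 6) + 6) + 3) (RoundInv I X r) (fun Y =>
      ∀ (i : ℕ), i < n → ∀ (j : ℕ), j < n → ∀ (k : ℕ), k < n →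
        ∀ (hi : i < n) (hj : j < n) (hk : k < n),
        X (R.2.1, ⟨i, hi⟩, ⟨k, hk⟩) + X (R.2.2, ⟨k, hk⟩, ⟨j, hj⟩) ≤ Y (R.1, ⟨i, hi⟩, ⟨j, hj⟩)) := by
  have hset : ∀ {x y v w : ℕ} {s : Store}, x ≠ y → s.int x = w →
      (s.setInt (.dir y) v).int x = w := by
    intro x y v w s hxy h
    simp [Store.setInt, Operand.addr, hxy, h]
  refine Establishes.forLoop (fun i Y Y' hY h j hj k hk _ _ _ => (h j hj k hk _ _ _).trans (hY _))
    (fun s h => ⟨h.int_zero, h.int_one⟩) (fun s v h => h.setInt (by norm_num) (by norm_num) v)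
    fun i hi => ?_
  refine Establishes.forLoop (fun j Y Y' hY h k hk _ _ _ => (h k hk _ _ _).trans (hY _))
    (fun s h => ⟨h.1.int_zero, h.1.int_one⟩)
    (fun s v h => ⟨h.1.setInt (by norm_num) (by norm_num) v, hset (by norm_num) h.2⟩)
    fun j hj => ?_
  refine Establishes.forLoop (fun k Y Y' hY h _ _ _ => (h _ _ _).trans (hY _))
    (fun s h => ⟨h.1.1.int_zero, h.1.1.int_one⟩)
    (fun s v h => ⟨⟨h.1.1.setInt (by norm_num) (by norm_num) v, hset (by norm_num) h.1.2⟩,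
      hset (by norm_num) h.2⟩)
    fun k hk => ?_
  intro s hs
  exact (relaxEntry_establishes hR ⟨i, hi⟩ ⟨j, hj⟩ ⟨k, hk⟩ s hs).mono le_rfl
    fun s' h => ⟨h.1, h.2.1, fun _ _ _ => h.2.2⟩

theorem relaxRules_establishes (l : List (Fin 7 × Fin 7 × Fin 7)) (hl : l ⊆ composeRules) :
    Establishes (l.foldr (fun r c => .seq (relaxMatrix r) c) .skip)
      (l.length * (n * (n * (n * 43 + 6) + 6) + 4) + 1) (RoundInv I X r) (fun Y =>
      ∀ R ∈ l, ∀ i j k : Fin n, X (R.2.1, i, k) + X (R.2.2, k, j) ≤ Y (R.1, i, j)) := by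
  induction l with
  | nil =>
    intro s hs
    refine (Terminates.skip (Q := (· = s)) rfl).mono (by simp) ?_
    rintro s' rfl
    exact ⟨hs, le_rfl, by simp⟩
  | cons R l ih =>
    intro s hs
    refine (Establishes.seq ?_ (relaxMatrix_establishes (hl (List.mem_cons_self)))
      (ih fun _ h => hl (List.mem_cons_of_mem _ h)) s hs).mono ?_ ?_
    · intro Y Y' hY h i hi j hj k hk _ _ _
      exact (h i hi j hj k hk _ _ _).trans (hY _)
    · rw [List.length_cons, add_mul]
      omega
    · rintro s' ⟨h1, h2, h3, h4⟩
      refine ⟨h1, h2, fun R' hR' i j k => ?_⟩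
      rcases List.mem_cons.1 hR' with rfl | hR'
      · exact h3 i i.2 j j.2 k k.2 _ _ _
      · exact h4 R' hR' i j k

theorem relaxRound_terminates {s : Store} (hs : Sound I s) (h4 : s.int 4 = r) :
    Terminates relaxRound s (9 * (n * (n * (n * 43 + 6) + 6) + 4) + 3) fun s' =>
      RoundInv I s.entry r s' ∧
        ∀ a b c : Entry n, Compose a b c → s.entry b + s.entry c ≤ s'.entry a := by
  refine (Terminates.seq (T := 1) (T' := 9 * (n * (n * (n * 43 + 6) + 6) + 4) + 1)
    (Terminates.instr ?_)).mono (by omega) fun _ h => h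
  have h : RoundInv I s.entry r (Instr.exec s (.natConst (.dir 11) 0)) :=
    ⟨hs.setInt (by norm_num) 0, by simpa [Instr.exec, Store.setInt, Operand.addr] using h4,
      fun a => le_rfl, Or.inl ⟨by simp [Instr.exec, Store.setInt, Operand.addr], fun a => rfl⟩⟩
  refine (relaxRules_establishes composeRules (List.Subset.refl _) _ h).mono le_rfl ?_
  rintro s' ⟨h1, -, h2⟩
  refine ⟨h1, ?_⟩
  rintro ⟨z, i, j⟩ ⟨u, i', k⟩ ⟨v, k', j'⟩ ⟨hR, h3, h4, h5⟩
  simp only at hR h3 h4 h5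
  subst h3 h4 h5
  exact h2 _ hR _ _ _

/-! ### The main loop and its running time. -/

variable (I)

/-- The invariant of the main loop: the entries are at least the weights of all derivation trees up
to the depth `r + 1`, and the flag tells whether the last round changed anything. -/
structure MainInv (r : ℕ) (s : Store) : Prop extends Sound I s where
  entry_le : ∀ a, I.entry a ≤ s.entry a
  weight_le : ∀ t : DTree (Entry n), t.IsDer Compose I.entry → t.depth ≤ r + 1 →
    (t.weight I.entry : ℝ) ≤ s.entry t.root
  flag : 0 < r → s.int 11 = 0 ∧ (∀ a b c : Entry n, Compose a b c →
      s.entry b + s.entry c ≤ s.entry a) ∨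
    s.int 11 = 1 ∧ ∃ t : DTree (Entry n), t.IsDer Compose I.entry ∧
      ∀ t' : DTree (Entry n), t'.IsDer Compose I.entry → t'.root = t.root → t'.depth ≤ r →
        t'.weight I.entry < t.weight I.entry

variable {I}

theorem DTree.one_le_depth {α : Type} (t : DTree α) : 1 ≤ t.depth := by
  cases t <;> simp [DTree.depth]

/-- The two subtrees of a tree of depth at most `r + 2` are dominated by the entries before the
round, and one relaxation combines them. If the flag stays unset, the entries before and after
agree, so the relaxed inequalities express closure. -/
theorem MainInv.round {s s' : Store} (h : MainInv I r s) (h' : RoundInv I s.entry r s')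
    (hle : ∀ a b c : Entry n, Compose a b c → s.entry b + s.entry c ≤ s'.entry a) :
    MainInv I (r + 1) s' := by
  refine ⟨h'.toSound, fun a => (h.entry_le a).trans (h'.le a), fun t ht hd => ?_, fun _ => ?_⟩
  · cases t with
    | leaf a => exact (h.weight_le _ ht (by simp [DTree.depth])).trans (h'.le _)
    | node a u v =>
      simp only [DTree.depth] at hd
      have h1 := h.weight_le u ht.2.1 (by omega)
      have h2 := h.weight_le v ht.2.2 (by omega)
      rw [DTree.weight, WithBot.coe_add]
      exact (add_le_add h1 h2).trans (hle _ _ _ ht.1)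
  · rcases h'.flag with ⟨h1, h2⟩ | ⟨h1, t, ht, hlt⟩
    · refine Or.inl ⟨h1, fun a b c habc => ?_⟩
      rw [h2 b, h2 c]
      exact hle a b c habc
    · refine Or.inr ⟨h1, t, ht, fun t' ht' hr hd => ?_⟩
      have := (h.weight_le t' ht' hd).trans_lt (hr ▸ hlt)
      exact WithBot.coe_lt_coe.1 this

theorem MainInv.setInt {s : Store} (h : MainInv I r s) (v : ℕ) :
    MainInv I r (s.setInt (.dir 4) v) := by
  refine ⟨h.toSound.setInt (by norm_num) v, h.entry_le, h.weight_le, ?_⟩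
  have h11 : (s.setInt (.dir 4) v).int 11 = s.int 11 := by
    simp [Store.setInt, Operand.addr]
  rw [h11]
  exact h.flag

theorem decisionProgram_terminates (hn : 1 ≤ n) (I : Instance ℝ n) :
    Terminates decisionProgram (inputStore I)
      (7 * (n * n) * (9 * (n * (n * (n * 43 + 6) + 6) + 4) + 6) + 15) fun s =>
      (InfWeightUltimatePath n I → s.int 0 = 1) ∧ (¬ InfWeightUltimatePath n I → s.int 0 = 0) := by
  refine (Terminates.seq (T := 9)
    (T' := 7 * (n * n) * (9 * (n * (n * (n * 43 + 6) + 6) + 4) + 6) + 3 + 1 + 1)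
    (Terminates.block ?_)).mono (by omega) fun _ h => h
  have hstart : MainInv I 0 ([Instr.natConst (.dir 1) 1, .natOp .mul (.dir 2) (.dir 0) (.dir 0),
      .natConst (.dir 12) 7, .natOp .mul (.dir 3) (.dir 12) (.dir 2)].foldl Instr.exec
        (inputStore I)) := by
    have hentry : ∀ a : Entry n, (inputStore I).entry a = I.entry a := inputStore_num_address I
    refine ⟨⟨?_, ?_, ?_, ?_, fun a x hx => ?_⟩, fun a => (hentry a).ge, fun t ht hd => ?_,
      fun h => absurd h (lt_irrefl 0)⟩
    · simp [Instr.exec, Store.setInt, Operand.addr, NatOp.eval, inputStore]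
    · simp [Instr.exec, Store.setInt, Operand.addr, NatOp.eval, inputStore]
    · simp [Instr.exec, Store.setInt, Operand.addr, NatOp.eval, inputStore]
    · simp [Instr.exec, Store.setInt, Operand.addr, NatOp.eval, inputStore]
    · have hx' : I.entry a = x := (hentry a).symm.trans hx
      exact ⟨.leaf a, by simp [DTree.IsDer, hx'], rfl, by simp [DTree.weight, hx']⟩
    · cases t with
      | leaf a =>
        refine le_trans ?_ (hentry a).ge
        obtain ⟨y, hy⟩ := WithBot.ne_bot_iff_exists.1 ht
        simp [DTree.weight, ← hy]
      | node a u v =>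
        have := u.one_le_depth
        simp only [DTree.depth] at hd
        omega
  refine Terminates.seq (T := 7 * (n * n) * (9 * (n * (n * (n * 43 + 6) + 6) + 4) + 6) + 3)
    (T' := 1) ((Terminates.forLoop_inv (b := 7 * (n * n)) (Inv := MainInv I)
    (fun i s h => h.int_three) (fun i _ s hs hi => ?_) (hstart.setInt 0)).mono le_rfl ?_)
  · refine (relaxRound_terminates hs.toSound hi).mono le_rfl ?_
    rintro s' ⟨h1, h2⟩
    exact ⟨h1.int_four, h1.int_one, (hs.round h1 h2).setInt _⟩
  · intro s hs
    refine Terminates.instr ?_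
    have h0 : (Instr.exec s (.natCopy (.dir 0) (.dir 11))).int 0 = s.int 11 := by
      simp [Instr.exec, Store.setInt, Operand.addr]
    rw [h0]
    -- Since `n ≥ 1`, at least one round was run and the flag carries information.
    rcases hs.flag (by positivity) with ⟨h1, h2⟩ | ⟨h1, t, ht, h2⟩
    · have hX : ClosedAbove I s.entry := ⟨hs.entry_le, h2⟩
      exact ⟨fun h => absurd h hX.not_hasInfWeightPath, fun _ => h1⟩
    · refine ⟨fun _ => h1, fun h => absurd (hasInfWeightPath_of_not_bounded I fun hb => ?_) h⟩
      -- The number of rounds equals the number of labels, so the dominating tree falls within the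
      -- depth that the witness `t` strictly beats.
      obtain ⟨t', ht1, ht2, ht3, ht4⟩ := hb.exists_depth_le ht
      have := h2 t' ht1 ht2 (by simpa using ht4)
      linarith

theorem decisionProgram_decides :
    DecidesInTime decisionProgram InfWeightUltimatePath fun n => 4000 * n ^ 5 := by
  intro n hn I
  obtain ⟨t, ht, s, hs, h⟩ := decisionProgram_terminates hn I
  refine ⟨t, ht.trans ?_, ?_⟩
  -- The expanded time bound has coefficients `2709 + 378 + 378 + 294 + 15 = 3774`, and every power
  -- of `n` in it is at most `n ^ 5`.
  · have h3 : n ^ 3 ≤ n ^ 5 := Nat.pow_le_pow_right hn (by norm_num)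
    have h4 : n ^ 4 ≤ n ^ 5 := Nat.pow_le_pow_right hn (by norm_num)
    have h5 : n ^ 2 ≤ n ^ 5 := Nat.pow_le_pow_right hn (by norm_num)
    have h6 : 1 ≤ n ^ 5 := Nat.one_le_pow _ _ hn
    ring_nf
    omega
  · have h1 : run decisionProgram I t = ([], s) := h []
    rw [h1]
    exact ⟨rfl, hs⟩

theorem cellRank_le (a : ℕ) : cellRank a ≤ 4 := by
  simp only [cellRank]
  split_ifs <;> omega

end UltimatePath

theorem mainTheorem6 :
    ∃ (c : UltimatePath.Prog) (K : ℕ),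
      UltimatePath.DecidesInTime c UltimatePath.InfWeightUltimatePath (fun n => K * n ^ 5) ∧
      UltimatePath.PolynomiallyBoundedNumbers c :=
  ⟨UltimatePath.decisionProgram, 4000, UltimatePath.decisionProgram_decides,
    UltimatePath.tame_polynomiallyBoundedNumbers UltimatePath.decisionProgram_tame
      UltimatePath.cellRank_le UltimatePath.decisionProgram_decides⟩
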